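/- **Setting.** Let $\mathcal X,\mathcal W\subseteq\mathbb R^d$ and $\mathcal Y\subseteq\mathbb R$, let $n,m\ge 1$ and $c>0$. Let $(X,W,Y)$ have an arbitrary true joint law on $\mathcal X\times\mathcal W\times\mathcal Y$ (classical and Berkson measurement error are special cases), with marginals $P^0_{XY}$, $P^0_X$, $P^0_{WY}$. For $\theta\in\Theta$ let $P_{g(x,\theta)}$ be the model's conditional law of $Y$ given $X=x$, and for a law $P$ on $\mathcal X$ write $P\,P_{g(X,\theta)}$ for the joint law of $(X,Y)$ with $X\sim P$, $Y\mid X=x\sim P_{g(x,\theta)}$. The data are $\mathcal D=\{(W_i,Y_i)\}_{i=1}^n$, i.i.d. from $P^0_{WY}$. Given $\mathcal D$, the pseudo-samples $S=\{\tilde X_{ij}\}_{i\le n,j\le m}$ are drawn independently with $\tilde X_{ij}\sim\Psi_n(\cdot\mid W_i,Y_i)=\int\Pi_\theta(\cdot\mid W_i,Y_i)\,\Pi_n(d\theta\mid\mathcal D)$, where $\Pi_n$ and $\Pi_\theta$ are (possibly misspecified) posteriors for $\theta$ and for $X$ given $\theta$. Let $Q_{XY,i}$ and $Q_{X,i}$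 be prior centring probability measures, which may depend on $\mathcal D$. Given $(\mathcal D,S)$, draw independently, for $i=1,\dots,n$, the random measures $$P^{\mathrm{DP}}_{XY,i}\sim \mathrm{DP}\Big(c+m,\tfrac{c}{c+m}Q_{XY,i}+\tfrac1{c+m}\sum_{j=1}^m\delta_{(\tilde X_{ij},Y_i)}\Big),\qquad P^{\mathrm{DP}}_{X,i}\sim \mathrm{DP}\Big(c+m,\tfrac{c}{c+m}Q_{X,i}+\tfrac1{c+m}\sum_{j=1}^m\delta_{\tilde X_{ij}}\Big).$$ For a kernel $k$, $\mathrm{MMD}_k(P,Q)$ is the RKHS norm of the difference of the mean embeddings of $P$ and $Q$; $\mathrm{MMD}_{k_X^2}(P,Q)$ is the MMD with kernel $k_X\otimes k_X$ between the laws of $(X,X)$, $X\sim P$, and $(X',X')$, $X'\sim Q$. Let $\hat\theta_n$ minimise over $\theta\in\Theta$ $$\mathrm{MMD}_k\Big(\tfrac1n\sum_i P^{\mathrm{DP}}_{XY,i},\ \big(\tfrac1n\sum_i P^{\mathrm{DP}}_{X,i}\big)P_{g(X,\theta)}\Big).$$ Put $P^{\mathrm{prior}}_{XY}=\frac1n\sum_iQ_{XY,i}$,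 $P^{\mathrm{prior}}_{X}=\frac1n\sum_iQ_{X,i}$, $P^{\mathrm{pseudo}}_{XY}=\frac1{nm}\sum_{i,j}\delta_{(\tilde X_{ij},Y_i)}$, $P^{\mathrm{pseudo}}_{X}=\frac1{nm}\sum_{i,j}\delta_{\tilde X_{ij}}$. **Assumptions.** (G1) $k((x,y),(x',y'))=k_X(x,x')k_Y(y,y')$ with $k_X,k_Y$ measurable, positive definite, characteristic, $\sup k_X=\kappa_X<\infty$, $\sup k_Y=\kappa_Y<\infty$; $\kappa:=\kappa_X\kappa_Y$. (G2) For each $\theta\in\Theta$ there is a bounded linear operator $\mathcal C_\theta$ from the RKHS of $k_X$ to the RKHS of $k_Y$ with $\mathcal C_\theta k_X(x,\cdot)=\int k_Y(y,\cdot)\,P_{g(x,\theta)}(dy)$ for all $x$, and $\sup_\theta\|\mathcal C_\theta\|_{\mathrm{op}}=\Lambda<\infty$. **Theorem 1 (generalisation error bound).** Under (G1) and (G2), $$\mathbb E_{\mathcal D,S}\Big[\mathbb E_{\mathrm{DP}}\big[\mathrm{MMD}_k(P^0_{XY},P^0_XP_{g(X,\hat\theta_n)})\,\big|\,\mathcal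 D,S\big]\Big]-\inf_{\theta\in\Theta}\mathrm{MMD}_k(P^0_{XY},P^0_XP_{g(X,\theta)})$$ $$\le \frac{2(\sqrt\kappa+\Lambda\kappa_X)}{\sqrt{n(c+m+1)}}+\frac{2c}{c+m}\mathbb E_{\mathcal D,S}\Big[\Lambda\,\mathrm{MMD}_{k_X^2}(P^0_X,P^{\mathrm{prior}}_X)+\mathrm{MMD}_k(P^0_{XY},P^{\mathrm{prior}}_{XY})\Big]$$ $$+\frac{2m}{c+m}\mathbb E_{\mathcal D,S}\Big[\Lambda\,\mathrm{MMD}_{k_X^2}(P^0_X,P^{\mathrm{pseudo}}_X)+\mathrm{MMD}_k(P^0_{XY},P^{\mathrm{pseudo}}_{XY})\Big].$$ If moreover $\kappa_X\le\kappa_Y$ (for instance for kernels normalised to $\kappa_X=\kappa_Y=1$), the same bound holds with first term $\dfrac{2\sqrt\kappa\,(1+\Lambda)}{\sqrt{n(c+m+1)}}$. -/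

import Mathlib

open MeasureTheory ProbabilityTheory
open scoped ENNReal

noncomputable section

/-! ### Positive definite kernels, their RKHS, mean embeddings and the MMD -/

/-- A real positive definite kernel on `Z`: symmetric, with positive semidefinite Gram matrices. -/
structure PDKernel (Z : Type*) where
  /-- the kernel function -/
  toFun : Z → Z → ℝ
  posSemidef : (Matrix.of toFun : Matrix Z Z ℝ).PosSemidef

namespace PDKernel

variable {Z Z' : Type*}

instance : CoeFun (PDKernel Z) (fun _ => Z → Z → ℝ) := ⟨PDKernel.toFun⟩

/-- The kernel as a matrix of operators on the one-dimensional space `ℝ`. -/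
def opMatrix (k : PDKernel Z) : Matrix Z Z (ℝ →L[ℝ] ℝ) :=
  Matrix.of fun x y => k x y • ContinuousLinearMap.id ℝ ℝ

theorem opMatrix_posSemidef (k : PDKernel Z) : k.opMatrix.PosSemidef := by
  refine ((RKHS.posSemidef_tfae (K := k.opMatrix)).out 0 2).mpr ?_
  refine ⟨?_, fun vv => ?_⟩
  · ext x y
    have h := k.posSemidef.1.apply x y
    simp only [Matrix.of_apply, star_trivial] at h
    rw [Matrix.conjTranspose_apply, ContinuousLinearMap.star_eq_adjoint]
    refine ext_inner_right ℝ fun w => ?_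
    rw [ContinuousLinearMap.adjoint_inner_left]
    simp [opMatrix, h, mul_comm]
  · have h := k.posSemidef.2 vv
    rw [Finsupp.sum_comm] at h
    simpa [opMatrix, mul_comm, mul_left_comm, mul_assoc] using h

instance (k : PDKernel Z) : Fact k.opMatrix.PosSemidef := ⟨k.opMatrix_posSemidef⟩

/-- The reproducing kernel Hilbert space of the kernel. -/
abbrev H (k : PDKernel Z) : Type _ := RKHS.OfKernel k.opMatrix

/-- The kernel section `k(·, x)` as an element of the RKHS. -/
def feature (k : PDKernel Z) (x : Z) : k.H := RKHS.kerFun k.H x (1 : ℝ)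

theorem feature_apply (k : PDKernel Z) (x y : Z) : k.feature x y = k y x := by
  rw [feature, RKHS.kerFun_apply, RKHS.OfKernel.kernel_ofKernel]
  simp [opMatrix]

open Classical in
/-- The mean embedding of `P`: the element of the RKHS which, as a function, is
`x ↦ ∫ k(x, z) dP(z)`. -/
def meanEmbedding [MeasurableSpace Z] (k : PDKernel Z) (P : Measure Z) : k.H :=
  if h : ∃ f : k.H, ∀ x, f x = ∫ z, k x z ∂P then h.choose else 0

/-- The maximum mean discrepancy `‖μ_P - μ_Q‖`, the norm being that of the RKHS. -/
def mmd [MeasurableSpace Z] (k : PDKernel Z) (P Q : Measure Z) : ℝ :=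
  ‖k.meanEmbedding P - k.meanEmbedding Q‖

/-- The MMD separates probability measures. -/
def IsCharacteristic [MeasurableSpace Z] (k : PDKernel Z) : Prop :=
  ∀ P Q : Measure Z, IsProbabilityMeasure P → IsProbabilityMeasure Q →
    (k.mmd P Q = 0 ↔ P = Q)

/-- The tensor product kernel `((x, y), (x', y')) ↦ k(x, x') l(y, y')`. -/
def prod (k : PDKernel Z) (l : PDKernel Z') : PDKernel (Z × Z') where
  toFun p q := k p.1 q.1 * l p.2 q.2
  posSemidef :=
    (k.posSemidef.submatrix Prod.fst).hadamard (l.posSemidef.submatrix Prod.snd)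

/-- The MMD with kernel `k ⊗ k` between the laws of `(X, X)` and `(X', X')`, where `X ∼ P` and
`X' ∼ Q`. -/
def mmdSq [MeasurableSpace Z] (k : PDKernel Z) (P Q : Measure Z) : ℝ :=
  (k.prod k).mmd (P.map fun x => (x, x)) (Q.map fun x => (x, x))

end PDKernel

/-! ### The Dirichlet process -/

/-- The Dirichlet distribution with parameters `a i ≥ 0`, not all zero: the law of
`(G i / ∑ j, G j)_i` for independent `G i ∼ Gamma(a i, 1)`, where `G i = 0` if `a i = 0`. -/
def dirichlet {r : ℕ} (a : Fin r → ℝ) : Measure (Fin r → ℝ) :=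
  (Measure.pi fun i => if a i = 0 then Measure.dirac (0 : ℝ) else gammaMeasure (a i) 1).map
    fun g i => g i / ∑ j, g j

/-- `ν` is the law of a random probability measure `P ∼ DP(a, F)`. -/
structure IsDirichletProcess {Z : Type*} [MeasurableSpace Z] (a : ℝ) (F : Measure Z)
    (ν : Measure (Measure Z)) : Prop where
  ae_isProbabilityMeasure : ∀ᵐ P ∂ν, IsProbabilityMeasure P
  map_partition : ∀ (r : ℕ) (A : Fin r → Set Z), (∀ i, MeasurableSet (A i)) →
    Pairwise (fun i j => Disjoint (A i) (A j)) → (⋃ i, A i) = Set.univ →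
      ν.map (fun P i => P.real (A i)) = dirichlet fun i => a * F.real (A i)

/-! ### Finite products of Markov kernels -/

theorem measurable_pi_kernel {A ι : Type*} [Fintype ι] {B : ι → Type*} [MeasurableSpace A]
    [∀ i, MeasurableSpace (B i)] (κ : ∀ i, Kernel A (B i)) [∀ i, IsMarkovKernel (κ i)] :
    Measurable fun a => Measure.pi fun i => κ i a := by
  refine Measurable.measure_of_isPiSystem_of_isProbabilityMeasure
    generateFrom_pi.symm isPiSystem_pi ?_
  rintro _ ⟨s, hs, rfl⟩
  simp only [Measure.pi_pi]
  exact Finset.measurable_prod _ fun i _ => (κ i).measurable_coe (hs i (Set.mem_univ i))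

/-- The Markov kernel `a ↦ ⨂ i, κ i a`: given `a`, independent draws from the `κ i a`. -/
def piKernel {A ι : Type*} [Fintype ι] {B : ι → Type*} [MeasurableSpace A]
    [∀ i, MeasurableSpace (B i)] (κ : ∀ i, Kernel A (B i)) [∀ i, IsMarkovKernel (κ i)] :
    Kernel A (∀ i, B i) where
  toFun a := Measure.pi fun i => κ i a
  measurable' := measurable_pi_kernel κ

instance {A ι : Type*} [Fintype ι] {B : ι → Type*} [MeasurableSpace A]
    [∀ i, MeasurableSpace (B i)] (κ : ∀ i, Kernel A (B i)) [∀ i, IsMarkovKernel (κ i)] :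
    IsMarkovKernel (piKernel κ) :=
  ⟨fun a => inferInstanceAs (IsProbabilityMeasure (Measure.pi fun i => κ i a))⟩

/-! ### Data, pseudo-samples, base measures and the DP posteriors -/

/-- The average `n⁻¹ ∑ i, P i`. -/
def avgMeasure {Z : Type*} [MeasurableSpace Z] {n : ℕ} (P : Fin n → Measure Z) : Measure Z :=
  (n : ℝ≥0∞)⁻¹ • ∑ i, P i

section Sampling

variable {X W Y T : Type*} [MeasurableSpace X] [MeasurableSpace W] [MeasurableSpace Y]
  [MeasurableSpace T] {n m : ℕ}

/-- The posterior predictive kernel `Ψ(dx | w, y) = ∫ postX(dx | θ, w, y) postΘ(dθ | D)`, as a kernel in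
`(D, (w, y))`. -/
def predictive (postX : Kernel (T × W × Y) X) (postΘ : Kernel (Fin n → W × Y) T) :
    Kernel ((Fin n → W × Y) × W × Y) X :=
  postX ∘ₖ (postΘ.prodMkRight (W × Y) ×ₖ Kernel.deterministic Prod.snd measurable_snd)

instance (postX : Kernel (T × W × Y) X) [IsMarkovKernel postX] (postΘ : Kernel (Fin n → W × Y) T)
    [IsMarkovKernel postΘ] : IsMarkovKernel (predictive postX postΘ) := by
  unfold predictive; infer_instance

/-- The conditional law of the pseudo-samples `S = (X̃ᵢⱼ)` given the data `D = ((wᵢ, yᵢ))ᵢ`: they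
are independent, with `X̃ᵢⱼ ∼ Ψ(· | D, wᵢ, yᵢ)`. -/
def pseudoSampleKernel (m : ℕ) (Ψ : Kernel ((Fin n → W × Y) × W × Y) X) [IsMarkovKernel Ψ] :
    Kernel (Fin n → W × Y) (Fin n → Fin m → X) :=
  piKernel fun i : Fin n => piKernel fun _ : Fin m =>
    Ψ.comap (fun D => (D, D i)) (measurable_id.prodMk (measurable_pi_apply i))

/-- The joint law of `(D, S)`: i.i.d. observed pairs from `P`, then the pseudo-samples. -/
def dataLaw (m : ℕ) (P : Measure (W × Y)) (Ψ : Kernel ((Fin n → W × Y) × W × Y) X)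
    [IsMarkovKernel Ψ] : Measure ((Fin n → W × Y) × (Fin n → Fin m → X)) :=
  (Measure.pi fun _ => P) ⊗ₘ pseudoSampleKernel m Ψ

/-- The base measure `c / (c + m) • Q + 1 / (c + m) • ∑ j, δ_{z j}` of a DP posterior. -/
def baseMeasure {Z : Type*} [MeasurableSpace Z] (c : ℝ) (Q : Measure Z) (z : Fin m → Z) :
    Measure Z :=
  ENNReal.ofReal (c / (c + m)) • Q + ENNReal.ofReal (1 / (c + m)) • ∑ j, Measure.dirac (z j)

/-- The empirical law `(nm)⁻¹ ∑ᵢⱼ δ_{z i j}`. -/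
def empirical {Z : Type*} [MeasurableSpace Z] (z : Fin n → Fin m → Z) : Measure Z :=
  ((n : ℝ≥0∞) * (m : ℝ≥0∞))⁻¹ • ∑ i, ∑ j, Measure.dirac (z i j)

/-- The joint law, given `(D, S)`, of the realisations of the `n` joint and the `n` marginal DP
posteriors: all `2n` of them are independent. -/
def dpKernel {A : Type*} [MeasurableSpace A] (Γ : Fin n → Kernel A (Measure (X × Y)))
    [∀ i, IsMarkovKernel (Γ i)] (Γ' : Fin n → Kernel A (Measure X)) [∀ i, IsMarkovKernel (Γ' i)] :
    Kernel A ((Fin n → Measure (X × Y)) × (Fin n → Measure X)) :=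
  piKernel Γ ×ₖ piKernel Γ'

/-- The objective `MMD_k(n⁻¹ ∑ Pᵢ, (n⁻¹ ∑ Pᵢ') P_{g(X, θ)})` at realisations `(P, P')` of the joint
and marginal DP posteriors, for the conditional law `η` of `Y` given `X`. -/
def objective (k : PDKernel (X × Y)) (p : (Fin n → Measure (X × Y)) × (Fin n → Measure X))
    (η : Kernel X Y) : ℝ :=
  k.mmd (avgMeasure p.1) (avgMeasure p.2 ⊗ₘ η)

/-- The risk `MMD_k(P⁰_XY, P⁰_X P_{g(X, θ)})`, for the conditional law `η` of `Y` given `X`. -/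
def risk (k : PDKernel (X × Y)) (P : Measure (X × Y)) (η : Kernel X Y) : ℝ :=
  k.mmd P (P.fst ⊗ₘ η)

end Sampling

end

noncomputable section

/-! ### Second moments of the Dirichlet distribution with two parameters -/

section GammaRatio

/-! The bound is proved for fixed `(D, S)` and then integrated. Write `P̄` and `P̄'` for the
averages of the joint and marginal DP draws. Since the MMD is a distance between mean embeddings,
the triangle inequality and the minimality of the estimator bound its risk by the risk of any `θ`,
plus twice the error of `P̄` and twice the cost of replacing `P̄'` by the true marginal inside the
model (`risk_le_of_objective_le`).

That cost is at most `Λ` times an MMD for the kernel `kX²` (`mmd_compProd_le`). Integrating out `y`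
turns the joint MMD into the MMD of `G(x, x') = kX(x, x') ⟨C φ(x), C φ(x')⟩`. The kernel `Λ² kX² -
G` is the Schur product of `kX` with `Λ² ⟨φ, φ⟩ - ⟨C φ, C φ⟩`, which is positive semidefinite
because `‖C‖ ≤ Λ`. Its own squared MMD is therefore nonnegative, and this is the inequality sought.

Each remaining error splits into fluctuation and bias. For `P ∼ DP(a, F)` the mean of `P ⊗ P` is
`a/(a+1) F ⊗ F` plus `1/(a+1)` times `F` on the diagonal (`bind_prod`), so the squared distance from
`μ_P` to `μ_F` has mean `(∫ k(z, z) dF - ‖μ_F‖²)/(a+1)`. Centred embeddings of independent draws are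
orthogonal in mean, so averaging `n` of them gains a factor `1/n`, and Jensen's inequality removes
the square. With `a = c + m` this is the first term of the bound. The bias is the distance from the
truth to the averaged base measure, a mixture of prior and pseudo-sample laws with weights `c/(c+m)`
and `m/(c+m)`; convexity of the norm gives the other two terms.

The DP is specified through its partition laws, so all of this rests on one moment: the second
moment of a coordinate of a two-parameter Dirichlet vector. -/

theorem lintegral_rpow_mul_exp_neg_mul_Ioi {a r : ℝ} (ha : 0 < a) (hr : 0 < r) :
    ∫⁻ x in Set.Ioi (0 : ℝ), ENNReal.ofReal (x ^ (a - 1) * Real.exp (-(r * x)))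
      = ENNReal.ofReal ((1 / r) ^ a * Real.Gamma a) := by
  have h := Real.integral_rpow_mul_exp_neg_mul_Ioi ha hr
  have hpos : 0 < (1 / r) ^ a * Real.Gamma a :=
    mul_pos (Real.rpow_pos_of_pos (by positivity) _) (Real.Gamma_pos_of_pos ha)
  rw [← h, ofReal_integral_eq_lintegral_ofReal]
  -- Integrability comes from the value: a non-integrable function has integral `0`, and this one is
  -- positive.
  · exact not_imp_comm.1 integral_undef (by rw [h]; exact hpos.ne')
  · filter_upwards [ae_restrict_mem measurableSet_Ioi] with x hx
    have : (0 : ℝ) < x := hx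
    positivity

theorem lintegral_gammaMeasure_one {a : ℝ} (f : ℝ → ℝ≥0∞) (hf : Measurable f) :
    ∫⁻ x, f x ∂(gammaMeasure a 1)
      = ∫⁻ x in Set.Ioi 0,
          ENNReal.ofReal (1 / Real.Gamma a * x ^ (a - 1) * Real.exp (-x)) * f x := by
  have hm : Measurable (gammaPDF a 1) := (measurable_gammaPDFReal a 1).ennreal_ofReal
  rw [gammaMeasure, lintegral_withDensity_eq_lintegral_mul _ hm hf]
  have h : ∀ x ∉ Set.Ici (0 : ℝ), (gammaPDF a 1 * f) x = 0 := fun x hx => by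
    simp [gammaPDF_of_neg (not_le.1 hx)]
  rw [← setLIntegral_eq_of_support_subset (s := Set.Ici (0 : ℝ))
    (fun x hx => by_contra fun h' => hx (h x h')), setLIntegral_congr Ioi_ae_eq_Ici.symm]
  refine setLIntegral_congr_fun measurableSet_Ioi fun x hx => ?_
  simp [gammaPDF_of_nonneg (le_of_lt hx)]

theorem ae_pos_gammaMeasure (a r : ℝ) : ∀ᵐ x ∂(gammaMeasure a r), 0 < x := by
  have hm : Measurable (gammaPDF a r) := (measurable_gammaPDFReal a r).ennreal_ofReal
  rw [gammaMeasure, ae_withDensity_iff hm]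
  have h0 : ∀ᵐ x : ℝ, x ≠ 0 := by simp [ae_iff, measure_singleton]
  filter_upwards [h0] with x hx0 hx
  by_contra hneg
  exact hx (gammaPDF_of_neg (lt_of_le_of_ne (not_lt.1 hneg) hx0))

theorem lintegral_pow_mul_exp_gammaMeasure {a l : ℝ} (ha : 0 < a) (hl : 0 ≤ l) (p : ℕ) :
    ∫⁻ x, ENNReal.ofReal (x ^ p * Real.exp (-(l * x))) ∂(gammaMeasure a 1)
      = ENNReal.ofReal (Real.Gamma (a + p) / Real.Gamma a * (1 + l) ^ (-(a + p))) := by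
  have hG := Real.Gamma_pos_of_pos ha
  rw [lintegral_gammaMeasure_one _ (by fun_prop)]
  have : ∀ x ∈ Set.Ioi (0 : ℝ),
      ENNReal.ofReal (1 / Real.Gamma a * x ^ (a - 1) * Real.exp (-x))
        * ENNReal.ofReal (x ^ p * Real.exp (-(l * x)))
      = ENNReal.ofReal (1 / Real.Gamma a)
        * ENNReal.ofReal (x ^ (a + p - 1) * Real.exp (-((1 + l) * x))) := fun x hx => by
    have hx : 0 < x := hx
    rw [← ENNReal.ofReal_mul (by positivity), ← ENNReal.ofReal_mul (by positivity)]
    congr 1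
    rw [show a + p - 1 = (a - 1) + p by ring, Real.rpow_add hx, Real.rpow_natCast,
      show -((1 + l) * x) = -x + -(l * x) by ring, Real.exp_add]
    ring
  rw [setLIntegral_congr_fun measurableSet_Ioi this, lintegral_const_mul _ (by fun_prop),
    lintegral_rpow_mul_exp_neg_mul_Ioi (by positivity) (by positivity),
    ← ENNReal.ofReal_mul (by positivity)]
  congr 1
  rw [Real.rpow_neg (by positivity), one_div (1 + l), Real.inv_rpow (by positivity)]
  ring

theorem lintegral_mul_one_add_rpow {u : ℝ} (hu : 0 < u) :
    ∫⁻ l in Set.Ioi (0 : ℝ), ENNReal.ofReal (l * (1 + l) ^ (-(u + 2)))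
      = ENNReal.ofReal (1 / (u * (u + 1))) := by
  -- The antiderivative comes from `l = (1 + l) - 1`, which splits the integrand into `(1 +
  -- l)^(-(u+1)) - (1 + l)^(-(u+2))`.
  have hd : ∀ x ∈ Set.Ici (0 : ℝ), HasDerivAt
      (fun l : ℝ => -(1 + l) ^ (-u) / u + (1 + l) ^ (-(u + 1)) / (u + 1))
      (x * (1 + x) ^ (-(u + 2))) x := fun x hx => by
    have hx : 0 ≤ x := hx
    have h1 : ∀ p : ℝ, HasDerivAt (fun l : ℝ => (1 + l) ^ p) (p * (1 + x) ^ (p - 1)) x := fun p => by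
      have := ((hasDerivAt_id x).const_add 1).rpow_const (p := p) (Or.inl (by simp; positivity))
      simpa using this
    refine (((h1 (-u)).neg.div_const u).add ((h1 (-(u + 1))).div_const (u + 1))).congr_deriv ?_
    have h2 : (1 + x) ^ (-u - 1) = (1 + x) * (1 + x) ^ (-(u + 2)) := by
      rw [show -u - 1 = 1 + -(u + 2) by ring, Real.rpow_add (by positivity), Real.rpow_one]
    rw [h2, show -(u + 1) - 1 = -(u + 2) by ring]
    field_simp
    ring
  have hpos : ∀ x ∈ Set.Ioi (0 : ℝ), 0 ≤ x * (1 + x) ^ (-(u + 2)) := fun x hx => by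
    have hx : 0 < x := hx
    positivity
  have ht : ∀ p : ℝ, 0 < p → Filter.Tendsto (fun l : ℝ => (1 + l) ^ (-p)) Filter.atTop (nhds 0) :=
    fun p hp => (tendsto_rpow_neg_atTop hp).comp (Filter.tendsto_atTop_add_const_left _ 1
      Filter.tendsto_id)
  have htend : Filter.Tendsto
      (fun l : ℝ => -(1 + l) ^ (-u) / u + (1 + l) ^ (-(u + 1)) / (u + 1)) Filter.atTop (nhds 0) := by
    simpa using ((ht u hu).neg.div_const u).add ((ht (u + 1) (by positivity)).div_const (u + 1))
  rw [← ofReal_integral_eq_lintegral_ofReal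
    (integrableOn_Ioi_deriv_of_nonneg' hd hpos htend)
    ((ae_restrict_mem measurableSet_Ioi).mono hpos),
    integral_Ioi_of_hasDerivAt_of_nonneg' hd hpos htend]
  congr 1
  simp
  field_simp
  ring

/-- With `z = x + y`, this replaces the denominator of the Dirichlet ratio by an exponential, which
factors over `x` and `y`. -/
theorem ofReal_inv_add_sq {z : ℝ} (hz : 0 < z) :
    ∫⁻ l in Set.Ioi (0 : ℝ), ENNReal.ofReal (l * Real.exp (-(l * z)))
      = ENNReal.ofReal ((1 / z) ^ 2) := by
  have h := lintegral_rpow_mul_exp_neg_mul_Ioi (a := 2) two_pos hz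
  norm_num at h
  simpa [mul_comm z, Real.Gamma_two] using h

/-- By Tonelli the Laplace variable `l` is integrated last. The Gamma integrals give `s (s + 1) (1 +
l)^(-(s+2))` and `(1 + l)^(-t)`, which leaves `lintegral_mul_one_add_rpow` with `u = s + t`. -/
theorem lintegral_sq_ratio_gamma {s t : ℝ} (hs : 0 < s) (ht : 0 < t) :
    ∫⁻ x, ∫⁻ y, ENNReal.ofReal ((x / (x + y)) ^ 2) ∂(gammaMeasure t 1) ∂(gammaMeasure s 1)
      = ENNReal.ofReal (s * (s + 1) / ((s + t) * (s + t + 1))) := by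
  have := isProbabilityMeasure_gammaMeasure hs one_pos
  have := isProbabilityMeasure_gammaMeasure ht one_pos
  have h1 : ∀ᵐ x ∂(gammaMeasure s 1),
      ∫⁻ y, ENNReal.ofReal ((x / (x + y)) ^ 2) ∂(gammaMeasure t 1)
      = ∫⁻ l in Set.Ioi (0 : ℝ), ENNReal.ofReal l
          * ENNReal.ofReal (x ^ 2 * Real.exp (-(l * x)))
          * ENNReal.ofReal ((1 + l) ^ (-t)) := by
    filter_upwards [ae_pos_gammaMeasure s 1] with x hx
    have h2 : ∀ᵐ y ∂(gammaMeasure t 1), ENNReal.ofReal ((x / (x + y)) ^ 2)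
        = ∫⁻ l in Set.Ioi (0 : ℝ), ENNReal.ofReal l
          * ENNReal.ofReal (x ^ 2 * Real.exp (-(l * x)))
          * ENNReal.ofReal (y ^ 0 * Real.exp (-(l * y))) := by
      filter_upwards [ae_pos_gammaMeasure t 1] with y hy
      rw [div_eq_mul_one_div, mul_pow, ENNReal.ofReal_mul (by positivity),
        ← ofReal_inv_add_sq (by positivity), ← lintegral_const_mul _ (by fun_prop)]
      refine setLIntegral_congr_fun measurableSet_Ioi fun l hl => ?_
      have hl : 0 < l := hl
      rw [← ENNReal.ofReal_mul (by positivity), ← ENNReal.ofReal_mul (by positivity),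
        ← ENNReal.ofReal_mul (by positivity)]
      congr 1
      rw [show -(l * (x + y)) = -(l * x) + -(l * y) by ring, Real.exp_add]
      ring
    rw [lintegral_congr_ae h2, lintegral_lintegral_swap (by fun_prop)]
    refine setLIntegral_congr_fun measurableSet_Ioi fun l hl => ?_
    have hl : 0 < l := hl
    rw [lintegral_const_mul _ (by fun_prop), lintegral_pow_mul_exp_gammaMeasure ht hl.le]
    simp [(Real.Gamma_pos_of_pos ht).ne']
  rw [lintegral_congr_ae h1, lintegral_lintegral_swap (by fun_prop)]
  have h3 : ∀ l ∈ Set.Ioi (0 : ℝ), ∫⁻ x, ENNReal.ofReal l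
          * ENNReal.ofReal (x ^ 2 * Real.exp (-(l * x)))
          * ENNReal.ofReal ((1 + l) ^ (-t)) ∂(gammaMeasure s 1)
      = ENNReal.ofReal (s * (s + 1)) * ENNReal.ofReal (l * (1 + l) ^ (-(s + t + 2))) :=
    fun l hl => by
    have hl : 0 < l := hl
    rw [lintegral_mul_const _ (by fun_prop), lintegral_const_mul _ (by fun_prop),
      lintegral_pow_mul_exp_gammaMeasure hs hl.le]
    have hG := Real.Gamma_pos_of_pos hs
    have hG' : Real.Gamma (s + (2 : ℕ)) = (s + 1) * (s * Real.Gamma s) := by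
      rw [← Real.Gamma_add_one hs.ne', ← Real.Gamma_add_one (by positivity)]
      norm_num [add_assoc]
    rw [hG', ← ENNReal.ofReal_mul (by positivity), ← ENNReal.ofReal_mul (by positivity),
      ← ENNReal.ofReal_mul (by positivity)]
    congr 1
    rw [show -(s + t + 2) = -(s + (2 : ℕ)) + -t by push_cast; ring, Real.rpow_add (by positivity)]
    field_simp
  rw [setLIntegral_congr_fun measurableSet_Ioi h3, lintegral_const_mul _ (by fun_prop),
    lintegral_mul_one_add_rpow (by positivity), ← ENNReal.ofReal_mul (by positivity)]
  congr 1
  ring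

/-- A zero parameter has to be allowed, since a cell of a partition may be null for the base
measure. The ratio is then almost surely `1` (if `t = 0`) or `0` (if `s = 0`), in agreement with the
formula. -/
theorem lintegral_sq_dirichlet_two {s t : ℝ} (hs : 0 ≤ s) (ht : 0 ≤ t) (hst : 0 < s + t) :
    ∫⁻ p, ENNReal.ofReal (p 0 ^ 2) ∂(dirichlet ![s, t])
      = ENNReal.ofReal (s * (s + 1) / ((s + t) * (s + t + 1))) := by
  have hP : ∀ a : ℝ, 0 ≤ a →
      IsProbabilityMeasure (if a = 0 then Measure.dirac (0 : ℝ) else gammaMeasure a 1) := by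
    intro a ha
    split_ifs with h
    · infer_instance
    · exact isProbabilityMeasure_gammaMeasure (lt_of_le_of_ne ha (Ne.symm h)) one_pos
  have : ∀ i, IsProbabilityMeasure ((fun i => if (![s, t] : Fin 2 → ℝ) i = 0 then
      Measure.dirac (0 : ℝ) else gammaMeasure ((![s, t] : Fin 2 → ℝ) i) 1) i) := by
    intro i; fin_cases i
    · exact hP s hs
    · exact hP t ht
  rw [dirichlet, lintegral_map (by fun_prop) (by fun_prop)]
  have hmp := measurePreserving_piFinTwo (fun i => if (![s, t] : Fin 2 → ℝ) i = 0 then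
      Measure.dirac (0 : ℝ) else gammaMeasure ((![s, t] : Fin 2 → ℝ) i) 1)
  have := hmp.lintegral_comp (f := fun q : ℝ × ℝ => ENNReal.ofReal ((q.1 / (q.1 + q.2)) ^ 2))
    (by fun_prop)
  simp only [MeasurableEquiv.piFinTwo_apply] at this
  simp only [Fin.sum_univ_two]
  rw [this]
  simp only [Matrix.cons_val_zero, Matrix.cons_val_one]
  rcases ht.eq_or_lt with rfl | ht
  · have hs : 0 < s := by linarith
    have := isProbabilityMeasure_gammaMeasure hs one_pos
    simp only [hs.ne', if_false, if_true]
    rw [lintegral_prod _ (by fun_prop)]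
    have h1 : ∀ᵐ x ∂(gammaMeasure s 1),
      ∫⁻ y, ENNReal.ofReal ((x / (x + y)) ^ 2) ∂(Measure.dirac (0 : ℝ)) = 1 := by
      filter_upwards [ae_pos_gammaMeasure s 1] with x hx
      rw [lintegral_dirac' _ (by fun_prop)]
      simp [hx.ne']
    rw [lintegral_congr_ae h1]
    simp only [lintegral_const, measure_univ, mul_one, add_zero]
    rw [div_self (by positivity), ENNReal.ofReal_one]
  have := isProbabilityMeasure_gammaMeasure ht one_pos
  simp only [ht.ne', if_false]
  rcases hs.eq_or_lt with rfl | hs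
  · simp only [if_true]
    rw [lintegral_prod _ (by fun_prop)]
    simp
  · simp only [hs.ne', if_false]
    rw [lintegral_prod _ (by fun_prop)]
    exact lintegral_sq_ratio_gamma hs ht

end GammaRatio

/-! ### Mean embeddings of bounded measurable kernels -/

namespace PDKernel

open scoped InnerProductSpace

variable {Z Z' : Type*}

theorem inner_feature (k : PDKernel Z) (f : k.H) (x : Z) : ⟪f, k.feature x⟫_ℝ = f x := by
  rw [feature, RKHS.inner_kerFun]; simp

theorem symm (k : PDKernel Z) (x y : Z) : k x y = k y x := by
  simpa using k.posSemidef.1.apply y x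

theorem inner_feature_feature (k : PDKernel Z) (x y : Z) :
    ⟪k.feature x, k.feature y⟫_ℝ = k x y := by
  rw [inner_feature, feature_apply, symm]

/-- The kernel is measurable and its diagonal is bounded by `B`. -/
structure IsBounded [MeasurableSpace Z] (k : PDKernel Z) (B : ℝ) : Prop where
  measurable : Measurable fun p : Z × Z => k p.1 p.2
  diag_le : ∀ z, k z z ≤ B

theorem diag_nonneg (k : PDKernel Z) (z : Z) : 0 ≤ k z z := by
  rw [← inner_feature_feature]; exact real_inner_self_nonneg

theorem norm_feature (k : PDKernel Z) (z : Z) : ‖k.feature z‖ = √(k z z) := by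
  rw [← inner_feature_feature, real_inner_self_eq_norm_sq, Real.sqrt_sq (norm_nonneg _)]

theorem span_feature_dense (k : PDKernel Z) (f : k.H) :
    f ∈ closure (Submodule.span ℝ (Set.range k.feature) : Set k.H) := by
  have h := RKHS.kerFun_dense (𝕜 := ℝ) k.H
  have hf : f ∈ (Submodule.span ℝ {RKHS.kerFun k.H x v | (x) (v)}).topologicalClosure := by
    rw [h]; trivial
  refine closure_mono ?_ hf
  refine Submodule.span_le.2 ?_
  rintro _ ⟨x, v, rfl⟩
  have : RKHS.kerFun k.H x v = v • k.feature x := by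
    rw [feature, ← map_smul]; simp
  rw [this]
  exact Submodule.smul_mem _ _ (Submodule.subset_span ⟨x, rfl⟩)

section Measurable

variable [MeasurableSpace Z] [MeasurableSpace Z'] {k : PDKernel Z} {B : ℝ}

theorem IsBounded.norm_feature_le (h : k.IsBounded B) (z : Z) : ‖k.feature z‖ ≤ √B := by
  rw [norm_feature]; exact Real.sqrt_le_sqrt (h.diag_le z)

theorem IsBounded.abs_le (h : k.IsBounded B) (x y : Z) : |k x y| ≤ B := by
  have hB : 0 ≤ B := (k.diag_nonneg x).trans (h.diag_le x)
  rw [← inner_feature_feature]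
  calc _ ≤ ‖k.feature x‖ * ‖k.feature y‖ := abs_real_inner_le_norm _ _
    _ ≤ √B * √B := by gcongr <;> exact h.norm_feature_le _
    _ = B := Real.mul_self_sqrt hB

/-- Finite combinations of kernel sections are measurable and dense. Norm limits in the RKHS are
pointwise limits because evaluations are continuous. -/
theorem IsBounded.measurable_coe (h : k.IsBounded B) (f : k.H) : Measurable f := by
  have hspan : ∀ g ∈ Submodule.span ℝ (Set.range k.feature), Measurable (g : Z → ℝ) := by
    intro g hg
    induction hg using Submodule.span_induction with
    | mem g hg =>
      obtain ⟨x, rfl⟩ := hg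
      simp only [funext fun y => k.feature_apply x y]
      exact h.measurable.comp (measurable_id.prodMk measurable_const)
    | zero => rw [RKHS.coe_zero]; exact measurable_zero
    | add g g' _ _ hg hg' => rw [RKHS.coe_add]; exact hg.add hg'
    | smul a g _ hg => rw [RKHS.coe_smul]; exact hg.const_smul a
  obtain ⟨u, hu, hlim⟩ := mem_closure_iff_seq_limit.1 (k.span_feature_dense f)
  refine measurable_of_tendsto_metrizable (fun i => hspan (u i) (hu i)) ?_
  exact tendsto_pi_nhds.2 fun x => ((RKHS.continuous_eval x).tendsto f).comp hlim

theorem IsBounded.abs_coe_le (h : k.IsBounded B) (f : k.H) (x : Z) : |f x| ≤ ‖f‖ * √B := by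
  rw [← inner_feature]
  exact (abs_real_inner_le_norm _ _).trans
    (mul_le_mul_of_nonneg_left (h.norm_feature_le x) (norm_nonneg _))

theorem IsBounded.integrable_coe (h : k.IsBounded B) (f : k.H) (P : Measure Z)
    [IsFiniteMeasure P] : Integrable f P :=
  Integrable.of_bound (h.measurable_coe f).aestronglyMeasurable (‖f‖ * √B)
    (ae_of_all _ fun x => h.abs_coe_le f x)

theorem IsBounded.integrable_right (h : k.IsBounded B) (x : Z) (P : Measure Z)
    [IsFiniteMeasure P] : Integrable (fun y => k x y) P :=
  Integrable.of_bound (h.measurable.comp (measurable_const.prodMk measurable_id)).aestronglyMeasurable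
    B (ae_of_all _ fun y => h.abs_le x y)

/-- Integration against `P` is a bounded functional on the RKHS. Its Riesz representer is the mean
embedding, so no vector-valued integral of the feature map, and no separability, is needed. -/
theorem IsBounded.exists_riesz (h : k.IsBounded B) (P : Measure Z) [IsFiniteMeasure P] :
    ∃ g : k.H, ∀ f : k.H, ⟪g, f⟫_ℝ = ∫ z, f z ∂P := by
  let L : k.H →ₗ[ℝ] ℝ :=
    { toFun := fun f => ∫ z, f z ∂P
      map_add' := fun f g => by
        simp only [RKHS.coe_add, Pi.add_apply]
        exact integral_add (h.integrable_coe f P) (h.integrable_coe g P)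
      map_smul' := fun a f => by
        simp only [RKHS.coe_smul, Pi.smul_apply, RingHom.id_apply, smul_eq_mul]
        exact integral_const_mul _ _ }
  let L' : k.H →L[ℝ] ℝ := L.mkContinuous (√B * P.real Set.univ) fun f => by
    have := norm_integral_le_of_norm_le_const (μ := P) (f := f) (C := ‖f‖ * √B)
      (ae_of_all _ fun x => h.abs_coe_le f x)
    calc _ ≤ ‖f‖ * √B * P.real Set.univ := this
      _ = _ := by ring
  exact ⟨(InnerProductSpace.toDual ℝ k.H).symm L', fun f => by
    rw [InnerProductSpace.toDual_symm_apply]; rfl⟩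

theorem IsBounded.exists_meanEmbedding (h : k.IsBounded B) (P : Measure Z) [IsFiniteMeasure P] :
    ∃ f : k.H, ∀ x, f x = ∫ z, k x z ∂P := by
  obtain ⟨g, hg⟩ := h.exists_riesz P
  refine ⟨g, fun x => ?_⟩
  rw [← inner_feature, hg]
  simp only [feature_apply, k.symm x]

theorem IsBounded.meanEmbedding_apply (h : k.IsBounded B) (P : Measure Z) [IsFiniteMeasure P]
    (x : Z) : k.meanEmbedding P x = ∫ z, k x z ∂P := by
  rw [meanEmbedding, dif_pos (h.exists_meanEmbedding P)]
  exact (h.exists_meanEmbedding P).choose_spec x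

theorem IsBounded.meanEmbedding_eq (h : k.IsBounded B) (P : Measure Z) [IsFiniteMeasure P]
    {f : k.H} (hf : ∀ x, f x = ∫ z, k x z ∂P) : k.meanEmbedding P = f :=
  RKHS.ext fun x => by rw [h.meanEmbedding_apply, hf]

theorem IsBounded.inner_meanEmbedding (h : k.IsBounded B) (P : Measure Z) [IsFiniteMeasure P]
    (f : k.H) : ⟪f, k.meanEmbedding P⟫_ℝ = ∫ z, f z ∂P := by
  obtain ⟨g, hg⟩ := h.exists_riesz P
  have : k.meanEmbedding P = g := h.meanEmbedding_eq P fun x => by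
    rw [← inner_feature, hg]
    simp only [feature_apply, k.symm x]
  rw [this, real_inner_comm, hg]

/-- The energy `∬ k(x, y) dQ(y) dP(x)`. -/
def energy (k : PDKernel Z) (P Q : Measure Z) : ℝ := ∫ x, ∫ y, k x y ∂Q ∂P

theorem IsBounded.inner_meanEmbedding_meanEmbedding (h : k.IsBounded B) (P Q : Measure Z)
    [IsFiniteMeasure P] [IsFiniteMeasure Q] :
    ⟪k.meanEmbedding P, k.meanEmbedding Q⟫_ℝ = k.energy P Q := by
  rw [real_inner_comm, h.inner_meanEmbedding]
  simp only [h.meanEmbedding_apply, energy]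

/-- Energies are scalar double integrals, so MMDs living in different RKHSs can be compared and
their measurability read off. -/
theorem IsBounded.mmd_sq (h : k.IsBounded B) (P Q : Measure Z)
    [IsFiniteMeasure P] [IsFiniteMeasure Q] :
    k.mmd P Q ^ 2 = k.energy P P - 2 * k.energy P Q + k.energy Q Q := by
  rw [mmd, norm_sub_sq_real, ← real_inner_self_eq_norm_sq, ← real_inner_self_eq_norm_sq]
  simp only [h.inner_meanEmbedding_meanEmbedding]

theorem mmd_nonneg (k : PDKernel Z) (P Q : Measure Z) : 0 ≤ k.mmd P Q := norm_nonneg _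

theorem mmd_comm (k : PDKernel Z) (P Q : Measure Z) : k.mmd P Q = k.mmd Q P := norm_sub_rev _ _

theorem mmd_triangle (k : PDKernel Z) (P Q R : Measure Z) :
    k.mmd P R ≤ k.mmd P Q + k.mmd Q R := norm_sub_le_norm_sub_add_norm_sub _ _ _

theorem IsBounded.norm_meanEmbedding_le (h : k.IsBounded B) (P : Measure Z)
    [IsProbabilityMeasure P] : ‖k.meanEmbedding P‖ ≤ √B := by
  refine Real.le_sqrt_of_sq_le ?_
  rw [← real_inner_self_eq_norm_sq, h.inner_meanEmbedding_meanEmbedding, energy]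
  refine (Real.le_norm_self _).trans ((norm_integral_le_of_norm_le_const (C := B)
    (ae_of_all _ fun x => ?_)).trans (by simp))
  exact (norm_integral_le_of_norm_le_const (C := B) (ae_of_all _ fun y => h.abs_le x y)).trans
    (by simp)

theorem IsBounded.mmd_le (h : k.IsBounded B) (P Q : Measure Z)
    [IsProbabilityMeasure P] [IsProbabilityMeasure Q] : k.mmd P Q ≤ 2 * √B :=
  (norm_sub_le _ _).trans (by
    linarith [h.norm_meanEmbedding_le P, h.norm_meanEmbedding_le Q])

theorem IsBounded.meanEmbedding_add (h : k.IsBounded B) (P Q : Measure Z)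
    [IsFiniteMeasure P] [IsFiniteMeasure Q] :
    k.meanEmbedding (P + Q) = k.meanEmbedding P + k.meanEmbedding Q :=
  h.meanEmbedding_eq _ fun x => by
    rw [RKHS.coe_add, Pi.add_apply, h.meanEmbedding_apply, h.meanEmbedding_apply,
      integral_add_measure (h.integrable_right x P) (h.integrable_right x Q)]

theorem IsBounded.meanEmbedding_smul (h : k.IsBounded B) {a : ℝ≥0∞} (ha : a ≠ ∞) (P : Measure Z)
    [IsFiniteMeasure P] : k.meanEmbedding (a • P) = a.toReal • k.meanEmbedding P := by
  have : IsFiniteMeasure (a • P) := Measure.smul_finite P ha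
  refine h.meanEmbedding_eq _ fun x => ?_
  rw [RKHS.coe_smul, Pi.smul_apply, h.meanEmbedding_apply, integral_smul_measure]

theorem IsBounded.meanEmbedding_sum (h : k.IsBounded B) {ι : Type*} (s : Finset ι)
    (P : ι → Measure Z) [∀ i, IsFiniteMeasure (P i)] :
    k.meanEmbedding (∑ i ∈ s, P i) = ∑ i ∈ s, k.meanEmbedding (P i) := by
  classical
  induction s using Finset.induction_on with
  | empty =>
    simp only [Finset.sum_empty]
    exact h.meanEmbedding_eq _ fun x => by simp
  | insert a s ha ih =>
    rw [Finset.sum_insert ha, Finset.sum_insert ha, ← ih, ← h.meanEmbedding_add]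

theorem IsBounded.meanEmbedding_avgMeasure (h : k.IsBounded B) {n : ℕ} (hn : 1 ≤ n)
    (P : Fin n → Measure Z) [∀ i, IsFiniteMeasure (P i)] :
    k.meanEmbedding (avgMeasure P) = (n : ℝ)⁻¹ • ∑ i, k.meanEmbedding (P i) := by
  rw [avgMeasure, h.meanEmbedding_smul (by simp; omega), h.meanEmbedding_sum]
  simp

/-- The pullback kernel `(x, y) ↦ k(f x, f y)`. -/
def comap (k : PDKernel Z) (f : Z' → Z) : PDKernel Z' where
  toFun x y := k (f x) (f y)
  posSemidef := k.posSemidef.submatrix f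

theorem IsBounded.comap (h : k.IsBounded B) {f : Z' → Z} (hf : Measurable f) :
    (k.comap f).IsBounded B where
  measurable := h.measurable.comp ((hf.comp measurable_fst).prodMk (hf.comp measurable_snd))
  diag_le z := h.diag_le (f z)

theorem IsBounded.stronglyMeasurable_integral (h : k.IsBounded B) (P : Measure Z)
    [IsFiniteMeasure P] : StronglyMeasurable fun x => ∫ y, k x y ∂P :=
  h.measurable.stronglyMeasurable.integral_prod_right'

theorem IsBounded.energy_map (h : k.IsBounded B) {f : Z' → Z} (hf : Measurable f)
    (P Q : Measure Z') [IsFiniteMeasure P] [IsFiniteMeasure Q] :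
    k.energy (P.map f) (Q.map f) = (k.comap f).energy P Q := by
  rw [energy, integral_map hf.aemeasurable (h.stronglyMeasurable_integral _).aestronglyMeasurable]
  refine integral_congr_ae (ae_of_all _ fun x => ?_)
  exact integral_map hf.aemeasurable
    (h.measurable.comp (measurable_const.prodMk measurable_id)).aestronglyMeasurable

theorem mmd_eq_of_sq_eq {k : PDKernel Z} {k' : PDKernel Z'} {P Q : Measure Z} {P' Q' : Measure Z'}
    (h : k.mmd P Q ^ 2 = k'.mmd P' Q' ^ 2) : k.mmd P Q = k'.mmd P' Q' :=
  (pow_left_inj₀ (k.mmd_nonneg _ _) (k'.mmd_nonneg _ _) two_ne_zero).1 h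

theorem IsBounded.mmd_map (h : k.IsBounded B) {f : Z' → Z} (hf : Measurable f)
    (P Q : Measure Z') [IsFiniteMeasure P] [IsFiniteMeasure Q] :
    k.mmd (P.map f) (Q.map f) = (k.comap f).mmd P Q := by
  apply mmd_eq_of_sq_eq
  rw [h.mmd_sq, (h.comap hf).mmd_sq, h.energy_map hf, h.energy_map hf, h.energy_map hf]

theorem IsBounded.prod {l : PDKernel Z'} {B' : ℝ} (h : k.IsBounded B) (h' : l.IsBounded B') :
    (k.prod l).IsBounded (B * B') where
  measurable := (h.measurable.comp (f := fun p : (Z × Z') × Z × Z' => (p.1.1, p.2.1))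
      (by fun_prop)).mul
    (h'.measurable.comp (f := fun p : (Z × Z') × Z × Z' => (p.1.2, p.2.2)) (by fun_prop))
  diag_le z := mul_le_mul (h.diag_le _) (h'.diag_le _) (l.diag_nonneg _)
    ((k.diag_nonneg z.1).trans (h.diag_le _))

/-- The kernel `(x, y) ↦ k(x, y)²`. -/
def sq (k : PDKernel Z) : PDKernel Z := (k.prod k).comap fun x => (x, x)

theorem IsBounded.sq (h : k.IsBounded B) : k.sq.IsBounded (B * B) :=
  (h.prod h).comap (measurable_id.prodMk measurable_id)

/-- Pulling `k ⊗ k` back along the diagonal map moves the discrepancy of the laws of `(X, X)` to the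
space of `X` itself, where the kernel is `k²`. -/
theorem IsBounded.mmdSq_eq (h : k.IsBounded B) (P Q : Measure Z) [IsFiniteMeasure P]
    [IsFiniteMeasure Q] : k.mmdSq P Q = k.sq.mmd P Q :=
  (h.prod h).mmd_map (measurable_id.prodMk measurable_id) P Q

end Measurable

/-! ### Positive semidefinite matrices built from a bounded operator -/

section Gram

variable {E F : Type*} [NormedAddCommGroup E] [InnerProductSpace ℝ E]
  [NormedAddCommGroup F] [InnerProductSpace ℝ F]

theorem sum_inner_eq_norm_sq (φ : Z → E) (v : Z →₀ ℝ) :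
    (v.sum fun i a => v.sum fun j b => star a * ⟪φ i, φ j⟫_ℝ * b)
      = ‖v.sum fun i a => a • φ i‖ ^ 2 := by
  rw [← real_inner_self_eq_norm_sq, Finsupp.sum_inner]
  refine Finsupp.sum_congr fun i _ => ?_
  rw [Finsupp.inner_sum]
  refine Finsupp.sum_congr fun j _ => ?_
  simp [inner_smul_left, inner_smul_right]
  ring

theorem posSemidef_inner (φ : Z → E) :
    (Matrix.of fun x y => ⟪φ x, φ y⟫_ℝ : Matrix Z Z ℝ).PosSemidef := by
  refine ⟨?_, fun v => ?_⟩
  · ext x y; simp [real_inner_comm]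
  · simp only [Matrix.of_apply]
    rw [sum_inner_eq_norm_sq]; positivity

/-- At coefficients `v`, with `f = ∑ vᵢ φ(i)`, the quadratic form is `L² ‖f‖² - ‖C f‖²`. -/
theorem posSemidef_sub_inner (φ : Z → E) (C : E →L[ℝ] F) {L : ℝ} (hL : ‖C‖ ≤ L) :
    (Matrix.of fun x y => L ^ 2 * ⟪φ x, φ y⟫_ℝ - ⟪C (φ x), C (φ y)⟫_ℝ :
      Matrix Z Z ℝ).PosSemidef := by
  refine ⟨?_, fun v => ?_⟩
  · ext x y; simp [real_inner_comm]
  · have : (v.sum fun i a => v.sum fun j b =>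
        star a * (L ^ 2 * ⟪φ i, φ j⟫_ℝ - ⟪C (φ i), C (φ j)⟫_ℝ) * b)
        = L ^ 2 * ‖v.sum fun i a => a • φ i‖ ^ 2 - ‖C (v.sum fun i a => a • φ i)‖ ^ 2 := by
      have hC : C (v.sum fun i a => a • φ i) = v.sum fun i a => a • C (φ i) := by
        simp [Finsupp.sum, map_sum]
      rw [hC, ← sum_inner_eq_norm_sq, ← sum_inner_eq_norm_sq (fun i => C (φ i)), Finsupp.mul_sum,
        ← Finsupp.sum_sub]
      refine Finsupp.sum_congr fun i _ => ?_
      rw [Finsupp.mul_sum, ← Finsupp.sum_sub]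
      refine Finsupp.sum_congr fun j _ => ?_
      ring
    simp only [Matrix.of_apply]
    rw [this, sub_nonneg, ← mul_pow]
    have := C.le_of_opNorm_le hL (v.sum fun i a => a • φ i)
    gcongr

end Gram

/-! ### Conditional mean embeddings -/

section Conditional

variable {X Y : Type*} [MeasurableSpace X] [MeasurableSpace Y] {kX : PDKernel X} {kY : PDKernel Y}
  {κX κY : ℝ}

/-- The kernel `(x, x') ↦ kX(x, x') ⟨C φ(x), C φ(x')⟩`. -/
def mulGram (kX : PDKernel X) (C : kX.H →L[ℝ] kY.H) : PDKernel X where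
  toFun x y := kX x y * ⟪C (kX.feature x), C (kX.feature y)⟫_ℝ
  posSemidef := kX.posSemidef.hadamard (posSemidef_inner fun x => C (kX.feature x))

/-- The kernel `(x, x') ↦ kX(x, x') (L² kX(x, x') - ⟨C φ(x), C φ(x')⟩)`. -/
def mulSubGram (kX : PDKernel X) (C : kX.H →L[ℝ] kY.H) {L : ℝ} (hL : ‖C‖ ≤ L) : PDKernel X where
  toFun x y := kX x y * (L ^ 2 * ⟪kX.feature x, kX.feature y⟫_ℝ
    - ⟪C (kX.feature x), C (kX.feature y)⟫_ℝ)
  posSemidef := kX.posSemidef.hadamard (posSemidef_sub_inner kX.feature C hL)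

theorem inner_conditional (hY : kY.IsBounded κY) {C : kX.H →L[ℝ] kY.H} {η : Kernel X Y}
    [IsMarkovKernel η] (hC : ∀ x, C (kX.feature x) = kY.meanEmbedding (η x)) (x x' : X) :
    ⟪C (kX.feature x), C (kX.feature x')⟫_ℝ = ∫ y, ∫ y', kY y y' ∂(η x') ∂(η x) := by
  rw [hC, hC, hY.inner_meanEmbedding_meanEmbedding, energy]

theorem IsBounded.isBounded_mulGram (hX : kX.IsBounded κX) (hY : kY.IsBounded κY) {C : kX.H →L[ℝ] kY.H}
    {η : Kernel X Y} [IsMarkovKernel η]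
    (hC : ∀ x, C (kX.feature x) = kY.meanEmbedding (η x)) :
    (mulGram kX C).IsBounded (κX * κY) where
  measurable := by
    refine hX.measurable.mul ?_
    -- The operator is replaced by a double integral against `η`, whose measurability follows from
    -- that of `kY` and of the Markov kernel.
    simp only [inner_conditional hY hC]
    have h1 : StronglyMeasurable fun q : (X × X) × Y => ∫ y', kY q.2 y' ∂(η q.1.2) :=
      StronglyMeasurable.integral_kernel_prod_right'
        (κ := η.comap (fun q : (X × X) × Y => q.1.2) (by fun_prop))
        (f := fun r : ((X × X) × Y) × Y => kY r.1.2 r.2)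
        (hY.measurable.comp (f := fun r : ((X × X) × Y) × Y => (r.1.2, r.2))
          (by fun_prop)).stronglyMeasurable
    exact (StronglyMeasurable.integral_kernel_prod_right'
        (κ := η.comap (fun q : X × X => q.1) (by fun_prop)) h1).measurable
  diag_le x := by
    refine mul_le_mul (hX.diag_le x) ?_ real_inner_self_nonneg
      ((kX.diag_nonneg x).trans (hX.diag_le x))
    rw [real_inner_self_eq_norm_sq, hC]
    obtain ⟨y⟩ : Nonempty Y := nonempty_of_isProbabilityMeasure (η x)
    exact (Real.le_sqrt (norm_nonneg _) ((kY.diag_nonneg y).trans (hY.diag_le y))).1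
      (hY.norm_meanEmbedding_le (η x))

theorem IsBounded.isBounded_mulSubGram (hX : kX.IsBounded κX) (hY : kY.IsBounded κY) {C : kX.H →L[ℝ] kY.H}
    {η : Kernel X Y} [IsMarkovKernel η]
    (hC : ∀ x, C (kX.feature x) = kY.meanEmbedding (η x)) {L : ℝ} (hL : ‖C‖ ≤ L) :
    (mulSubGram kX C hL).IsBounded (L ^ 2 * (κX * κX)) where
  measurable := by
    have h := ((hX.sq.measurable.const_mul (L ^ 2)).sub (hX.isBounded_mulGram hY hC).measurable)
    convert! h using 2 with p
    change kX _ _ * _ = L ^ 2 * (kX _ _ * kX _ _) - kX _ _ * _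
    rw [inner_feature_feature]; ring
  diag_le x := by
    have h1 := hX.sq.diag_le x
    have h2 := (mulGram kX C).diag_nonneg x
    have : mulSubGram kX C hL x x = L ^ 2 * kX.sq x x - mulGram kX C x x := by
      change kX _ _ * _ = L ^ 2 * (kX _ _ * kX _ _) - kX _ _ * _
      rw [inner_feature_feature]; ring
    rw [this]
    nlinarith [sq_nonneg L]

theorem IsBounded.energy_compProd (hX : kX.IsBounded κX) (hY : kY.IsBounded κY)
    {C : kX.H →L[ℝ] kY.H} {η : Kernel X Y} [IsMarkovKernel η]
    (hC : ∀ x, C (kX.feature x) = kY.meanEmbedding (η x)) (P Q : Measure X)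
    [IsFiniteMeasure P] [IsFiniteMeasure Q] :
    (kX.prod kY).energy (P ⊗ₘ η) (Q ⊗ₘ η) = (mulGram kX C).energy P Q := by
  have h := hX.prod hY
  have hb : ∀ p, Integrable (fun q => kX.prod kY p q) (Q ⊗ₘ η) := fun p => h.integrable_right p _
  rw [energy, Measure.integral_compProd (by
    simp only [← h.meanEmbedding_apply]; exact h.integrable_coe _ _)]
  refine integral_congr_ae (ae_of_all _ fun x => ?_)
  simp only
  have h1 : ∀ y, ∫ q, kX.prod kY (x, y) q ∂(Q ⊗ₘ η)
      = ∫ x', kX x x' * ∫ y', kY y y' ∂(η x') ∂Q := fun y => by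
    rw [Measure.integral_compProd (hb _)]
    refine integral_congr_ae (ae_of_all _ fun x' => ?_)
    exact integral_const_mul (kX x x') (fun y' => kY y y')
  simp only [h1]
  have hm : StronglyMeasurable fun p : Y × X => ∫ y', kY p.1 y' ∂(η p.2) :=
    StronglyMeasurable.integral_kernel_prod_right'
      (κ := η.comap (fun q : Y × X => q.2) (by fun_prop))
      (f := fun r : (Y × X) × Y => kY r.1.1 r.2)
      (hY.measurable.comp (f := fun r : (Y × X) × Y => (r.1.1, r.2))
        (by fun_prop)).stronglyMeasurable
  have hm' : StronglyMeasurable fun p : Y × X => kX x p.2 * ∫ y', kY p.1 y' ∂(η p.2) :=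
    (hX.measurable.comp (f := fun p : Y × X => (x, p.2)) (by fun_prop)).stronglyMeasurable.mul hm
  -- The integral over `x'` is brought outside that over `y`, so that at fixed `(x, x')` the two
  -- conditional integrals form `⟨C φ(x), C φ(x')⟩`.
  rw [integral_integral_swap]
  · refine integral_congr_ae (ae_of_all _ fun x' => ?_)
    change _ = kX x x' * _
    rw [inner_conditional hY hC]
    exact integral_const_mul (kX x x') _
  · refine Integrable.of_bound hm'.aestronglyMeasurable (κX * κY) (ae_of_all _ fun p => ?_)
    have h3 : ‖∫ y', kY p.1 y' ∂(η p.2)‖ ≤ κY :=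
      (norm_integral_le_of_norm_le_const (C := κY) (ae_of_all _ fun y => hY.abs_le _ y)).trans
        (by simp)
    simp only [Function.uncurry, norm_mul]
    exact mul_le_mul (hX.abs_le x p.2) h3 (norm_nonneg _) ((abs_nonneg _).trans (hX.abs_le x p.2))

/-- The difference `L² MMD_{k²}(P, Q)² - MMD(P η, Q η)²` is the squared MMD of `mulSubGram`, because
energies are linear in the kernel. Hence it is nonnegative. -/
theorem IsBounded.mmd_compProd_le (hX : kX.IsBounded κX) (hY : kY.IsBounded κY)
    {C : kX.H →L[ℝ] kY.H} {η : Kernel X Y} [IsMarkovKernel η]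
    (hC : ∀ x, C (kX.feature x) = kY.meanEmbedding (η x)) {L : ℝ} (hL : ‖C‖ ≤ L)
    (P Q : Measure X) [IsFiniteMeasure P] [IsFiniteMeasure Q] :
    (kX.prod kY).mmd (P ⊗ₘ η) (Q ⊗ₘ η) ≤ L * kX.mmdSq P Q := by
  have hL0 : 0 ≤ L := (norm_nonneg C).trans hL
  have hG := hX.isBounded_mulGram hY hC
  have hS := hX.isBounded_mulSubGram hY hC hL
  have hE : ∀ (P Q : Measure X) [IsFiniteMeasure P] [IsFiniteMeasure Q],
      (mulSubGram kX C hL).energy P Q = L ^ 2 * kX.sq.energy P Q - (mulGram kX C).energy P Q := by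
    intro P Q _ _
    have e1 : ∀ x y, mulSubGram kX C hL x y = L ^ 2 * kX.sq x y - mulGram kX C x y := fun x y => by
      change kX _ _ * _ = L ^ 2 * (kX _ _ * kX _ _) - kX _ _ * _
      rw [inner_feature_feature]; ring
    have e2 : ∀ x, ∫ y, mulSubGram kX C hL x y ∂Q
        = L ^ 2 * kX.sq.meanEmbedding Q x - (mulGram kX C).meanEmbedding Q x := fun x => by
      simp only [e1]
      rw [integral_sub ((hX.sq.integrable_right x Q).const_mul _) (hG.integrable_right x Q),
        integral_const_mul, hX.sq.meanEmbedding_apply, hG.meanEmbedding_apply]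
    rw [energy]
    simp only [e2]
    rw [integral_sub ((hX.sq.integrable_coe _ P).const_mul _) (hG.integrable_coe _ P),
      integral_const_mul]
    simp only [hX.sq.meanEmbedding_apply, hG.meanEmbedding_apply, energy]
  rw [hX.mmdSq_eq]
  refine le_of_sq_le_sq ?_ (mul_nonneg hL0 (mmd_nonneg _ _ _))
  have h0 := sq_nonneg ((mulSubGram kX C hL).mmd P Q)
  rw [hS.mmd_sq, hE, hE, hE] at h0
  rw [mul_pow, hX.sq.mmd_sq, (hX.prod hY).mmd_sq]
  simp only [hX.energy_compProd hY hC]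
  linarith

end Conditional

end PDKernel

/-! ### Moments of the Dirichlet process -/

section DirichletProcess

variable {Z : Type*} [MeasurableSpace Z]

theorem measurableSet_isProbabilityMeasure :
    MeasurableSet {P : Measure Z | IsProbabilityMeasure P} := by
  have : {P : Measure Z | IsProbabilityMeasure P} = (fun P => P Set.univ) ⁻¹' {1} := by
    ext P; exact isProbabilityMeasure_iff
  rw [this]
  exact Measure.measurable_coe .univ (measurableSet_singleton 1)

open Classical in
/-- The identity kernel on probability measures, and zero elsewhere. -/
def probKernel (Z : Type*) [MeasurableSpace Z] : Kernel (Measure Z) Z where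
  toFun P := if IsProbabilityMeasure P then P else 0
  measurable' := Measurable.ite measurableSet_isProbabilityMeasure measurable_id measurable_const

theorem probKernel_apply (P : Measure Z) [h : IsProbabilityMeasure P] : probKernel Z P = P :=
  if_pos h

theorem probKernel_apply_eq (P : Measure Z) :
    probKernel Z P = 0 ∨ IsProbabilityMeasure (probKernel Z P) := by
  by_cases h : IsProbabilityMeasure P
  · right; rwa [probKernel_apply]
  · left; exact if_neg h

instance : IsFiniteKernel (probKernel Z) := by
  refine ⟨1, ENNReal.one_lt_top, fun P => ?_⟩
  rcases probKernel_apply_eq P with h | h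
  · simp [h]
  · simp

theorem integral_bind_kernel {A : Type*} [MeasurableSpace A] (ν : Measure A) [IsFiniteMeasure ν]
    (η : Kernel A Z) {f : Z → ℝ} (hf : Integrable f (ν.bind η)) :
    ∫ z, f z ∂(ν.bind η) = ∫ a, ∫ z, f z ∂(η a) ∂ν := by
  have h : (η ∘ₖ Kernel.const Unit ν) () = ν.bind η := by
    rw [Kernel.comp_apply, Kernel.const_apply]
  rw [← h] at hf ⊢
  rw [Kernel.integral_comp hf, Kernel.const_apply]

theorem measurable_measureReal {A : Set Z} (hA : MeasurableSet A) :
    Measurable fun P : Measure Z => P.real A :=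
  (Measure.measurable_coe hA).ennreal_toReal

namespace IsDirichletProcess

variable {a : ℝ} {F : Measure Z} {ν : Measure (Measure Z)}

theorem integrable_mul [IsProbabilityMeasure ν] (h : IsDirichletProcess a F ν) {A B : Set Z} (hA : MeasurableSet A)
    (hB : MeasurableSet B) : Integrable (fun P : Measure Z => P.real A * P.real B) ν := by
  refine Integrable.of_bound
    ((measurable_measureReal hA).mul (measurable_measureReal hB)).aestronglyMeasurable 1 ?_
  filter_upwards [h.ae_isProbabilityMeasure] with P hP
  rw [norm_mul, Real.norm_of_nonneg measureReal_nonneg, Real.norm_of_nonneg measureReal_nonneg]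
  exact mul_le_one₀ measureReal_le_one measureReal_nonneg measureReal_le_one

/-- The partition `{A, Aᶜ}` makes `P(A)` the first coordinate of a Dirichlet vector with parameters
`a F(A)` and `a (1 - F(A))`, whose sum is `a`. -/
theorem integral_sq [IsProbabilityMeasure F] (h : IsDirichletProcess a F ν) (ha : 0 < a) {A : Set Z}
    (hA : MeasurableSet A) :
    ∫ P, P.real A ^ 2 ∂ν = F.real A * (a * F.real A + 1) / (a + 1) := by
  have hm := h.map_partition 2 ![A, Aᶜ]
    (by intro i; fin_cases i <;> simp [hA])
    (by
      intro i j hij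
      fin_cases i <;> fin_cases j <;> simp_all [disjoint_compl_right, disjoint_compl_left])
    (by
      ext z
      simp only [Set.mem_iUnion, Fin.exists_fin_two, Matrix.cons_val_zero, Matrix.cons_val_one,
        Set.mem_univ, iff_true]
      exact Classical.em _)
  have hvec : (fun i => a * F.real ((![A, Aᶜ] : Fin 2 → Set Z) i))
      = ![a * F.real A, a * (1 - F.real A)] := by
    ext i
    fin_cases i
    · rfl
    · simp [probReal_compl_eq_one_sub hA]
  rw [hvec] at hm
  have hF0 : 0 ≤ F.real A := measureReal_nonneg
  have hF1 : F.real A ≤ 1 := measureReal_le_one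
  have hd := lintegral_sq_dirichlet_two (s := a * F.real A) (t := a * (1 - F.real A))
    (by positivity) (mul_nonneg ha.le (by linarith)) (by ring_nf; exact ha)
  rw [← hm, lintegral_map (by fun_prop) (measurable_pi_lambda _ fun i => measurable_measureReal
    (by fin_cases i <;> simp [hA]))] at hd
  rw [integral_eq_lintegral_of_nonneg_ae (ae_of_all _ fun P => by positivity)
    ((measurable_measureReal hA).pow_const 2).aestronglyMeasurable]
  simp only [Matrix.cons_val_zero] at hd
  rw [hd, ENNReal.toReal_ofReal]
  · rw [show a * F.real A + a * (1 - F.real A) = a by ring]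
    field_simp
  · rw [show a * F.real A + a * (1 - F.real A) = a by ring]
    positivity

/-- Polarisation: `P(A ∪ B) = P(A) + P(B)`, and all three squares have known means. -/
theorem integral_mul_of_disjoint [IsProbabilityMeasure F] [IsProbabilityMeasure ν]
    (h : IsDirichletProcess a F ν) (ha : 0 < a) {A B : Set Z}
    (hA : MeasurableSet A) (hB : MeasurableSet B) (hAB : Disjoint A B) :
    ∫ P, P.real A * P.real B ∂ν = a * F.real A * F.real B / (a + 1) := by
  have h1 : ∫ P, P.real (A ∪ B) ^ 2 ∂ν
      = ∫ P, (P.real A ^ 2 + 2 * (P.real A * P.real B) + P.real B ^ 2) ∂ν := by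
    refine integral_congr_ae ?_
    filter_upwards [h.ae_isProbabilityMeasure] with P hP
    rw [measureReal_union hAB hB]; ring
  have hi2 : ∀ {A : Set Z}, MeasurableSet A → Integrable (fun P : Measure Z => P.real A ^ 2) ν :=
    fun hA => by simpa only [pow_two] using h.integrable_mul hA hA
  have hi3 : Integrable (fun P : Measure Z => P.real A ^ 2 + 2 * (P.real A * P.real B)) ν :=
    (hi2 hA).add ((h.integrable_mul hA hB).const_mul 2)
  rw [integral_add hi3 (hi2 hB), integral_add (hi2 hA) ((h.integrable_mul hA hB).const_mul 2), integral_const_mul,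
    h.integral_sq ha (hA.union hB), h.integral_sq ha hA, h.integral_sq ha hB,
    measureReal_union hAB hB] at h1
  have : a + 1 ≠ 0 := by positivity
  field_simp at h1 ⊢
  linarith

theorem integral_mul [IsProbabilityMeasure F] [IsProbabilityMeasure ν]
    (h : IsDirichletProcess a F ν) (ha : 0 < a) {A B : Set Z}
    (hA : MeasurableSet A) (hB : MeasurableSet B) :
    ∫ P, P.real A * P.real B ∂ν
      = a / (a + 1) * (F.real A * F.real B) + 1 / (a + 1) * F.real (A ∩ B) := by
  have hC := hA.inter hB
  have hA' := hA.diff hB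
  have hB' := hB.diff hA
  have hsplit : ∀ P : Measure Z, IsProbabilityMeasure P → P.real A * P.real B
      = P.real (A ∩ B) ^ 2 + P.real (A ∩ B) * P.real (B \ A) + P.real (A \ B) * P.real (A ∩ B)
        + P.real (A \ B) * P.real (B \ A) := fun P _ => by
    rw [← measureReal_inter_add_sdiff (s := A) hB, ← measureReal_inter_add_sdiff (s := B) hA,
      Set.inter_comm B A]
    ring
  have d1 : Disjoint (A ∩ B) (B \ A) := Set.disjoint_left.2 fun x hx hx' => hx'.2 hx.1
  have d2 : Disjoint (A \ B) (A ∩ B) := Set.disjoint_left.2 fun x hx hx' => hx.2 hx'.2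
  have d3 : Disjoint (A \ B) (B \ A) := Set.disjoint_left.2 fun x hx hx' => hx'.2 hx.1
  have hi : Integrable (fun P : Measure Z => P.real (A ∩ B) ^ 2) ν := by
    simpa only [pow_two] using h.integrable_mul hC hC
  have i1 := h.integrable_mul hC hB'
  have i2 := h.integrable_mul hA' hC
  have i3 := h.integrable_mul hA' hB'
  have i4 : Integrable (fun P : Measure Z => P.real (A ∩ B) ^ 2
      + P.real (A ∩ B) * P.real (B \ A)) ν := hi.add i1
  have i5 : Integrable (fun P : Measure Z => P.real (A ∩ B) ^ 2 + P.real (A ∩ B) * P.real (B \ A)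
      + P.real (A \ B) * P.real (A ∩ B)) ν := i4.add i2
  rw [integral_congr_ae (h.ae_isProbabilityMeasure.mono hsplit), integral_add i5 i3,
    integral_add i4 i2, integral_add hi i1, h.integral_sq ha hC,
    h.integral_mul_of_disjoint ha hC hB' d1, h.integral_mul_of_disjoint ha hA' hC d2,
    h.integral_mul_of_disjoint ha hA' hB' d3, hsplit F inferInstance]
  have : a + 1 ≠ 0 := by positivity
  field_simp
  ring

/-- Rectangles determine a finite measure on the product, so the moments of `integral_mul` identify
the mean of `P ⊗ P`, against which any bounded measurable kernel can then be integrated. Passing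
through `probKernel` loses nothing, as `ν`-almost every `P` is a probability measure. -/
theorem bind_prod [IsProbabilityMeasure F] [IsProbabilityMeasure ν]
    (h : IsDirichletProcess a F ν) (ha : 0 < a) :
    ν.bind (probKernel Z ×ₖ probKernel Z) = ENNReal.ofReal (a / (a + 1)) • F.prod F
      + ENNReal.ofReal (1 / (a + 1)) • F.map fun z => (z, z) := by
  symm
  have f1 : IsFiniteMeasure (ENNReal.ofReal (a / (a + 1)) • F.prod F) :=
    Measure.smul_finite _ ENNReal.ofReal_ne_top
  have f2 : IsFiniteMeasure (ENNReal.ofReal (1 / (a + 1)) • F.map fun z => (z, z)) :=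
    Measure.smul_finite _ ENNReal.ofReal_ne_top
  refine Measure.ext_prod fun {A B} hA hB => ?_
  have hl : ∫⁻ P, (probKernel Z ×ₖ probKernel Z) P (A ×ˢ B) ∂ν
      = ∫⁻ P, ENNReal.ofReal (P.real A * P.real B) ∂ν := by
    refine lintegral_congr_ae ?_
    filter_upwards [h.ae_isProbabilityMeasure] with P hP
    rw [Kernel.prod_apply, probKernel_apply, Measure.prod_prod, ENNReal.ofReal_mul measureReal_nonneg,
      ofReal_measureReal, ofReal_measureReal]
  rw [Measure.bind_apply (hA.prod hB) (Kernel.aemeasurable _), hl,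
    ← ofReal_integral_eq_lintegral_ofReal (h.integrable_mul hA hB)
      (ae_of_all _ fun P => by positivity), h.integral_mul ha hA hB]
  simp only [Measure.coe_add, Pi.add_apply, Measure.coe_smul, Pi.smul_apply, smul_eq_mul,
    Measure.prod_prod]
  rw [Measure.map_apply (by fun_prop) (hA.prod hB),
    ENNReal.ofReal_add (by positivity) (by positivity), ENNReal.ofReal_mul (by positivity),
    ENNReal.ofReal_mul (by positivity), ENNReal.ofReal_mul (by positivity), ofReal_measureReal,
    ofReal_measureReal, ofReal_measureReal]
  rfl

theorem bind_eq [IsProbabilityMeasure F] [IsProbabilityMeasure ν]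
    (h : IsDirichletProcess a F ν) (ha : 0 < a) : ν.bind (probKernel Z) = F := by
  ext A hA
  have hl : ∫⁻ P, probKernel Z P A ∂ν
      = ∫⁻ P, ENNReal.ofReal (P.real A * P.real Set.univ) ∂ν := by
    refine lintegral_congr_ae ?_
    filter_upwards [h.ae_isProbabilityMeasure] with P hP
    rw [probKernel_apply, probReal_univ, mul_one, ofReal_measureReal]
  rw [Measure.bind_apply hA (Kernel.aemeasurable _), hl,
    ← ofReal_integral_eq_lintegral_ofReal (h.integrable_mul hA .univ)
      -- First moments are the case `B = univ` of the second moments.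
      (ae_of_all _ fun P => by positivity), h.integral_mul ha hA .univ, probReal_univ,
      Set.inter_univ, ← ofReal_measureReal]
  congr 1
  have : a + 1 ≠ 0 := by positivity
  field_simp

end IsDirichletProcess

end DirichletProcess

/-! ### Measurability of energies and of the MMD -/

namespace PDKernel

open scoped InnerProductSpace

variable {Z A : Type*} [MeasurableSpace Z] [MeasurableSpace A] {k : PDKernel Z} {B : ℝ}

theorem IsBounded.measurable_energy (h : k.IsBounded B) (κ η : Kernel A Z) [IsFiniteKernel κ]
    [IsFiniteKernel η] : Measurable fun s => k.energy (κ s) (η s) := by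
  have h1 : StronglyMeasurable fun q : A × Z => ∫ y, k q.2 y ∂(η q.1) :=
    StronglyMeasurable.integral_kernel_prod_right'
      (κ := η.comap (fun q : A × Z => q.1) (by fun_prop))
      (f := fun r : (A × Z) × Z => k r.1.2 r.2)
      (h.measurable.comp (f := fun r : (A × Z) × Z => (r.1.2, r.2))
        (by fun_prop)).stronglyMeasurable
  exact (StronglyMeasurable.integral_kernel_prod_right' (κ := κ) h1).measurable

theorem IsBounded.measurable_mmd (h : k.IsBounded B) (κ η : Kernel A Z) [IsFiniteKernel κ]
    [IsFiniteKernel η] : Measurable fun s => k.mmd (κ s) (η s) := by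
  have : (fun s => k.mmd (κ s) (η s)) = fun s => √(k.energy (κ s) (κ s)
      - 2 * k.energy (κ s) (η s) + k.energy (η s) (η s)) := by
    ext s; rw [← h.mmd_sq, Real.sqrt_sq (k.mmd_nonneg _ _)]
  rw [this]
  exact (((h.measurable_energy κ κ).sub ((h.measurable_energy κ η).const_mul 2)).add
    (h.measurable_energy η η)).sqrt

/-- The centred mean embedding of a probability measure `P` (and `-μ_F` at other measures). -/
def centered (k : PDKernel Z) (F P : Measure Z) : k.H :=
  k.meanEmbedding (probKernel Z P) - k.meanEmbedding F

theorem IsBounded.norm_centered_le (h : k.IsBounded B) (F P : Measure Z)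
    [IsProbabilityMeasure F] : ‖k.centered F P‖ ≤ 2 * √B := by
  refine (norm_sub_le _ _).trans ?_
  have h1 : ‖k.meanEmbedding (probKernel Z P)‖ ≤ √B := by
    rcases probKernel_apply_eq P with h0 | h1
    · have : k.meanEmbedding (0 : Measure Z) = 0 := h.meanEmbedding_eq 0 fun x => by simp
      rw [h0, this]; simp
    · exact h.norm_meanEmbedding_le _
  linarith [h.norm_meanEmbedding_le F]

/-- The inner product of two centred mean embeddings. -/
def centeredInner (k : PDKernel Z) (F G P Q : Measure Z) : ℝ :=
  ⟪k.centered F P, k.centered G Q⟫_ℝ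

theorem IsBounded.measurable_centeredInner (h : k.IsBounded B) (F G : Measure Z)
    [IsProbabilityMeasure F] [IsProbabilityMeasure G] :
    Measurable fun p : Measure Z × Measure Z => k.centeredInner F G p.1 p.2 := by
  simp only [centeredInner, centered, inner_sub_left, inner_sub_right,
    h.inner_meanEmbedding_meanEmbedding]
  let κ₁ : Kernel (Measure Z × Measure Z) Z := (probKernel Z).comap Prod.fst measurable_fst
  let κ₂ : Kernel (Measure Z × Measure Z) Z := (probKernel Z).comap Prod.snd measurable_snd
  let F' : Kernel (Measure Z × Measure Z) Z := Kernel.const _ F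
  let G' : Kernel (Measure Z × Measure Z) Z := Kernel.const _ G
  exact ((h.measurable_energy κ₁ κ₂).sub (h.measurable_energy F' κ₂)).sub
    ((h.measurable_energy κ₁ G').sub (h.measurable_energy F' G'))

theorem IsBounded.abs_centeredInner_le (h : k.IsBounded B) (F G P Q : Measure Z)
    [IsProbabilityMeasure F] [IsProbabilityMeasure G] :
    |k.centeredInner F G P Q| ≤ (2 * √B) * (2 * √B) :=
  (abs_real_inner_le_norm _ _).trans (mul_le_mul (h.norm_centered_le F P) (h.norm_centered_le G Q)
    (norm_nonneg _) (by positivity))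

theorem IsBounded.integral_inner_centered (h : k.IsBounded B) {a : ℝ} (ha : 0 < a)
    {F : Measure Z} {ν : Measure (Measure Z)} [IsProbabilityMeasure F] [IsProbabilityMeasure ν]
    (hν : IsDirichletProcess a F ν) (f : k.H) : ∫ P, ⟪f, k.centered F P⟫_ℝ ∂ν = 0 := by
  have hF := hν.bind_eq ha
  have hint : Integrable f (ν.bind (probKernel Z)) := by rw [hF]; exact h.integrable_coe f F
  have h1 := integral_bind_kernel ν (probKernel Z) hint
  simp only [centered, inner_sub_right, h.inner_meanEmbedding]
  rw [integral_sub _ (integrable_const _), ← h1, hF]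
  · simp
  · refine Integrable.of_bound ((h.measurable_coe f).stronglyMeasurable.integral_kernel
      ).aestronglyMeasurable (‖f‖ * √B) (ae_of_all _ fun P => ?_)
    rcases probKernel_apply_eq P with h0 | h1
    · rw [h0]; simp; positivity
    · exact (norm_integral_le_of_norm_le_const (ae_of_all _ (h.abs_coe_le f))).trans (by simp)

theorem IsBounded.integral_centeredInner (h : k.IsBounded B) {a : ℝ} (ha : 0 < a)
    {F G : Measure Z} {ν : Measure (Measure Z)} [IsProbabilityMeasure G] [IsProbabilityMeasure ν]
    (hν : IsDirichletProcess a G ν) (P : Measure Z) : ∫ Q, k.centeredInner F G P Q ∂ν = 0 :=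
  h.integral_inner_centered ha hν _

/-- Integrating `k` against the mean of `P ⊗ P` gives the exact value `(∫ k(z, z) dF - ‖μ_F‖²)/(a +
1)`; the bound drops the square and uses `k(z, z) ≤ B`. -/
theorem IsBounded.integral_centeredInner_self_le (h : k.IsBounded B) {a : ℝ} (ha : 0 < a)
    {F : Measure Z} {ν : Measure (Measure Z)} [IsProbabilityMeasure F] [IsProbabilityMeasure ν]
    (hν : IsDirichletProcess a F ν) :
    ∫ P, k.centeredInner F F P P ∂ν ≤ B / (a + 1) := by
  have hm : Measurable fun P : Measure Z => k.centeredInner F F P P :=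
    (h.measurable_centeredInner F F).comp (f := fun P => (P, P)) (by fun_prop)
  have hi : Integrable (fun P => k.centeredInner F F P P) ν :=
    Integrable.of_bound hm.aestronglyMeasurable _
      (ae_of_all _ fun P => h.abs_centeredInner_le F F P P)
  -- `g` is the cross term in expanding `‖μ_P‖²` around `μ_F`; its mean is `0` because `P` has mean
  -- `F`.
  obtain ⟨g, hg⟩ : ∃ g : Measure Z → ℝ, ∀ P, g P = ⟪k.meanEmbedding F, k.centered F P⟫_ℝ :=
    ⟨_, fun _ => rfl⟩
  have hg0 : ∫ P, g P ∂ν = 0 := by simp only [hg, h.integral_inner_centered ha hν]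
  have hmf : Measurable g := by
    have : g = fun P => k.energy F (probKernel Z P) - k.energy F F := funext fun P => by
      rw [hg, centered, inner_sub_right, h.inner_meanEmbedding_meanEmbedding,
        h.inner_meanEmbedding_meanEmbedding]
    rw [this]
    exact (h.measurable_energy (Kernel.const _ F) (probKernel Z)).sub_const _
  have hif : Integrable g ν :=
    Integrable.of_bound hmf.aestronglyMeasurable (√B * (2 * √B)) (ae_of_all _ fun P => by
      rw [hg]
      exact (abs_real_inner_le_norm _ _).trans
        (mul_le_mul (h.norm_meanEmbedding_le F) (h.norm_centered_le F P) (norm_nonneg _)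
          (by positivity)))
  have hkk : ∀ μ : Measure (Z × Z), IsFiniteMeasure μ → Integrable (fun p => k p.1 p.2) μ :=
    fun μ _ => Integrable.of_bound h.measurable.aestronglyMeasurable B
      (ae_of_all _ fun p => h.abs_le p.1 p.2)
  have f1 : IsFiniteMeasure (ENNReal.ofReal (a / (a + 1)) • F.prod F) :=
    Measure.smul_finite _ ENNReal.ofReal_ne_top
  have f2 : IsFiniteMeasure (ENNReal.ofReal (1 / (a + 1)) • F.map fun z => (z, z)) :=
    Measure.smul_finite _ ENNReal.ofReal_ne_top
  have hbind := hν.bind_prod ha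
  have hE := integral_bind_kernel ν (probKernel Z ×ₖ probKernel Z)
    (f := fun p => k p.1 p.2) (by rw [hbind]; exact hkk _ inferInstance)
  rw [hbind, integral_add_measure (hkk _ f1) (hkk _ f2), integral_smul_measure,
    integral_smul_measure, integral_map (by fun_prop) h.measurable.aestronglyMeasurable,
    integral_prod _ (hkk _ inferInstance), ENNReal.toReal_ofReal (by positivity),
    ENNReal.toReal_ofReal (by positivity)] at hE
  have hprod : ∀ P : Measure Z, ∫ p, k p.1 p.2 ∂((probKernel Z ×ₖ probKernel Z) P)
      = k.centeredInner F F P P + 2 * g P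
        + k.energy F F := fun P => by
    rw [Kernel.prod_apply, integral_prod _ (hkk _ inferInstance), hg, centeredInner, centered,
      ← h.inner_meanEmbedding_meanEmbedding F F]
    change k.energy _ _ = _
    rw [← h.inner_meanEmbedding_meanEmbedding]
    simp only [inner_sub_left, inner_sub_right]
    rw [real_inner_comm (k.meanEmbedding F) (k.meanEmbedding (probKernel Z P))]
    ring
  simp only [hprod] at hE
  have hi2 : Integrable (fun P => k.centeredInner F F P P + 2 * g P) ν := hi.add (hif.const_mul 2)
  rw [integral_add hi2 (integrable_const _),
    integral_add hi (hif.const_mul 2), integral_const_mul,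
    hg0] at hE
  have hdiag : ∫ z, k z z ∂F ≤ B := by
    refine (Real.le_norm_self _).trans ((norm_integral_le_of_norm_le_const (C := B)
      (ae_of_all _ fun x => h.abs_le x x)).trans (by simp))
  have hFF : 0 ≤ k.energy F F := by
    rw [← h.inner_meanEmbedding_meanEmbedding]; exact real_inner_self_nonneg
  have heq : a / (a + 1) * k.energy F F + 1 / (a + 1) * ∫ z, k z z ∂F
      = ∫ P, k.centeredInner F F P P ∂ν + k.energy F F := by
    simpa [energy] using hE
  have ha1 : 0 < a + 1 := by positivity
  rw [le_div_iff₀ ha1]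
  field_simp at heq
  linarith

theorem IsBounded.mmd_avgMeasure_sq (h : k.IsBounded B) {n : ℕ} (hn : 1 ≤ n)
    (P F : Fin n → Measure Z) [∀ i, IsProbabilityMeasure (P i)] [∀ i, IsProbabilityMeasure (F i)] :
    k.mmd (avgMeasure P) (avgMeasure F) ^ 2
      = ((n : ℝ)⁻¹) ^ 2 * ∑ i, ∑ j, k.centeredInner (F i) (F j) (P i) (P j) := by
  have hc : ∀ i, k.centered (F i) (P i) = k.meanEmbedding (P i) - k.meanEmbedding (F i) :=
    fun i => by rw [centered, probKernel_apply]
  rw [mmd, h.meanEmbedding_avgMeasure hn, h.meanEmbedding_avgMeasure hn, ← smul_sub,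
    ← Finset.sum_sub_distrib, norm_smul, mul_pow, ← real_inner_self_eq_norm_sq (∑ i, _), sum_inner]
  simp only [inner_sum, centeredInner, hc]
  simp

/-! ### Independent Dirichlet processes -/

section Pi

variable {n : ℕ} {F : Fin n → Measure Z} {ν : Fin n → Measure (Measure Z)}
  [∀ i, IsProbabilityMeasure (F i)] [∀ i, IsProbabilityMeasure (ν i)] {a : ℝ}

theorem IsBounded.integrable_centeredInner_pi (h : k.IsBounded B) (i j : Fin n) :
    Integrable (fun P : Fin n → Measure Z => k.centeredInner (F i) (F j) (P i) (P j))
      (Measure.pi ν) := by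
  have hp : Measurable fun P : Fin n → Measure Z => (P i, P j) := by fun_prop
  have hm := (h.measurable_centeredInner (F i) (F j)).comp hp
  exact Integrable.of_bound hm.aestronglyMeasurable _
    (ae_of_all _ fun P => h.abs_centeredInner_le (F i) (F j) (P i) (P j))

/-- The pair `(P i, P j)` has a product law, and with `P i` fixed the integral over `P j` already
vanishes. -/
theorem IsBounded.integral_centeredInner_pi_of_ne (h : k.IsBounded B) (ha : 0 < a) {i j : Fin n}
    (hν : IsDirichletProcess a (F j) (ν j)) (hij : i ≠ j) :
    ∫ P, k.centeredInner (F i) (F j) (P i) (P j) ∂(Measure.pi ν) = 0 := by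
  have hind := (iIndepFun_pi (μ := ν) (X := fun _ P => P) (fun i => aemeasurable_id)).indepFun hij
  have hmap := hind.map_prod_eq_prod_map_map (measurable_pi_apply i).aemeasurable
    (measurable_pi_apply j).aemeasurable
  have hi : (Measure.pi ν).map (fun P => P i) = ν i := (measurePreserving_eval ν i).map_eq
  have hj : (Measure.pi ν).map (fun P => P j) = ν j := (measurePreserving_eval ν j).map_eq
  rw [hi, hj] at hmap
  have hm := h.measurable_centeredInner (F i) (F j)
  have hmp : Measurable fun P : Fin n → Measure Z => (P i, P j) := by fun_prop
  have := integral_map (μ := Measure.pi ν) hmp.aemeasurable hm.aestronglyMeasurable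
  rw [hmap, integral_prod _ (Integrable.of_bound hm.aestronglyMeasurable _
    (ae_of_all _ fun P => h.abs_centeredInner_le (F i) (F j) P.1 P.2))] at this
  rw [← this]
  simp only [h.integral_centeredInner ha hν, integral_zero]

theorem IsBounded.integral_centeredInner_pi_self_le (h : k.IsBounded B) (ha : 0 < a) {i : Fin n}
    (hν : IsDirichletProcess a (F i) (ν i)) :
    ∫ P, k.centeredInner (F i) (F i) (P i) (P i) ∂(Measure.pi ν) ≤ B / (a + 1) := by
  refine le_trans (le_of_eq ?_) (h.integral_centeredInner_self_le ha hν)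
  have hm : Measurable fun P : Measure Z => k.centeredInner (F i) (F i) P P :=
    (h.measurable_centeredInner (F i) (F i)).comp (f := fun P => (P, P)) (by fun_prop)
  have hi : (Measure.pi ν).map (fun P => P i) = ν i := (measurePreserving_eval ν i).map_eq
  have := integral_map (μ := Measure.pi ν) (measurable_pi_apply i).aemeasurable
    hm.aestronglyMeasurable
  rw [hi] at this
  exact this.symm

theorem ae_pi_isProbabilityMeasure {F : Fin n → Measure Z}
    (hν : ∀ i, IsDirichletProcess a (F i) (ν i)) :
    ∀ᵐ P ∂(Measure.pi ν), ∀ i, IsProbabilityMeasure (P i) := by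
  rw [ae_all_iff]
  exact fun i => (Measure.quasiMeasurePreserving_eval ν i).ae (hν i).ae_isProbabilityMeasure

theorem IsBounded.integral_mmd_avgMeasure_sq_le (h : k.IsBounded B) (ha : 0 < a) (hn : 1 ≤ n)
    (hν : ∀ i, IsDirichletProcess a (F i) (ν i)) :
    ∫ P, k.mmd (avgMeasure P) (avgMeasure F) ^ 2 ∂(Measure.pi ν) ≤ B / (n * (a + 1)) := by
  have hexp : ∀ᵐ P ∂(Measure.pi ν), k.mmd (avgMeasure P) (avgMeasure F) ^ 2
      = ((n : ℝ)⁻¹) ^ 2 * ∑ i, ∑ j, k.centeredInner (F i) (F j) (P i) (P j) := by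
    filter_upwards [ae_pi_isProbabilityMeasure hν] with P hP
    exact h.mmd_avgMeasure_sq hn P F
  rw [integral_congr_ae hexp, integral_const_mul, integral_finsetSum _ fun i _ =>
    integrable_finsetSum _ fun j _ => h.integrable_centeredInner_pi i j]
  simp only [integral_finsetSum _ fun j _ => h.integrable_centeredInner_pi _ j]
  -- Only the `n` diagonal terms survive; against the prefactor `n⁻²` they leave `1/n`.
  have hsum : ∑ i, ∑ j, ∫ P, k.centeredInner (F i) (F j) (P i) (P j) ∂(Measure.pi ν)
      ≤ n * (B / (a + 1)) := by
    calc _ ≤ ∑ _i : Fin n, B / (a + 1) := by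
          refine Finset.sum_le_sum fun i _ => ?_
          rw [Finset.sum_eq_single i
            (fun j _ hj => h.integral_centeredInner_pi_of_ne ha (hν j) hj.symm) (by simp)]
          exact h.integral_centeredInner_pi_self_le ha (hν i)
      _ = _ := by simp
  have hn0 : (0 : ℝ) < n := by exact_mod_cast hn
  calc _ ≤ ((n : ℝ)⁻¹) ^ 2 * (n * (B / (a + 1))) := by gcongr
    _ = _ := by field_simp

end Pi

end PDKernel

/-! ### Averages, empirical measures and base measures -/

section Measures

variable {Z A : Type*} [MeasurableSpace Z] [MeasurableSpace A] {n m : ℕ}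

theorem isProbabilityMeasure_avgMeasure (hn : 1 ≤ n) (P : Fin n → Measure Z)
    [∀ i, IsProbabilityMeasure (P i)] : IsProbabilityMeasure (avgMeasure P) := by
  refine ⟨?_⟩
  have : (n : ℝ≥0∞) ≠ 0 := by simp; omega
  simp [avgMeasure, ENNReal.inv_mul_cancel this]

theorem isProbabilityMeasure_empirical (hn : 1 ≤ n) (hm : 1 ≤ m) (z : Fin n → Fin m → Z) :
    IsProbabilityMeasure (empirical z) := by
  refine ⟨?_⟩
  have h1 : (n : ℝ≥0∞) ≠ 0 := by simp; omega
  have h2 : (m : ℝ≥0∞) ≠ 0 := by simp; omega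
  simp only [empirical, Measure.smul_apply, Measure.finsetSum_apply, measure_univ,
    Finset.sum_const, Finset.card_univ, Fintype.card_fin, nsmul_eq_mul, mul_one, smul_eq_mul]
  exact ENNReal.inv_mul_cancel (mul_ne_zero h1 h2) (by finiteness)

theorem isProbabilityMeasure_baseMeasure {c : ℝ} (hc : 0 < c) (Q : Measure Z)
    [IsProbabilityMeasure Q] (z : Fin m → Z) : IsProbabilityMeasure (baseMeasure c Q z) := by
  refine ⟨?_⟩
  simp only [baseMeasure, Measure.coe_add, Pi.add_apply, Measure.smul_apply,
    Measure.finsetSum_apply, measure_univ, Finset.sum_const, Finset.card_univ, Fintype.card_fin,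
    nsmul_eq_mul, mul_one, smul_eq_mul]
  rw [← ENNReal.ofReal_natCast, ← ENNReal.ofReal_mul (by positivity),
    ← ENNReal.ofReal_add (by positivity) (by positivity), ← ENNReal.ofReal_one]
  congr 1
  field_simp

theorem avgMeasure_baseMeasure {c : ℝ} (hm : 1 ≤ m) (Q : Fin n → Measure Z)
    (z : Fin n → Fin m → Z) :
    avgMeasure (fun i => baseMeasure c (Q i) (z i))
      = ENNReal.ofReal (c / (c + m)) • avgMeasure Q
        + ENNReal.ofReal (m / (c + m)) • empirical z := by
  have hm0 : (m : ℝ≥0∞) ≠ 0 := by simp; omega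
  have hγ : ENNReal.ofReal (m / (c + m)) * ((n : ℝ≥0∞) * m)⁻¹
      = (n : ℝ≥0∞)⁻¹ * ENNReal.ofReal (1 / (c + m)) := by
    rw [div_eq_mul_one_div (m : ℝ), ENNReal.ofReal_mul (by positivity), ENNReal.ofReal_natCast,
      ENNReal.mul_inv (by simp) (by simp)]
    calc _ = (n : ℝ≥0∞)⁻¹ * ENNReal.ofReal (1 / (c + m)) * ((m : ℝ≥0∞) * (m : ℝ≥0∞)⁻¹) := by ring
      _ = _ := by rw [ENNReal.mul_inv_cancel hm0 (by simp), mul_one]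
  simp only [avgMeasure, empirical, baseMeasure, smul_smul, hγ, Finset.sum_add_distrib,
    ← Finset.smul_sum, smul_add]
  rw [mul_comm (n : ℝ≥0∞)⁻¹ (ENNReal.ofReal (c / (c + m)))]

theorem measurable_avgMeasure : Measurable (avgMeasure : (Fin n → Measure Z) → Measure Z) := by
  refine Measure.measurable_of_measurable_coe _ fun s hs => ?_
  simp only [avgMeasure, Measure.smul_apply, Measure.finsetSum_apply, smul_eq_mul]
  exact (Finset.measurable_sum _ fun i _ =>
    (Measure.measurable_coe hs).comp (measurable_pi_apply i)).const_mul _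

theorem measurable_empirical {z : A → Fin n → Fin m → Z} (hz : ∀ i j, Measurable fun s => z s i j) :
    Measurable fun s => empirical (z s) := by
  refine Measure.measurable_of_measurable_coe _ fun B hB => ?_
  simp only [empirical, Measure.smul_apply, Measure.finsetSum_apply, smul_eq_mul]
  exact (Finset.measurable_sum _ fun i _ => Finset.measurable_sum _ fun j _ =>
    (Measure.measurable_coe hB).comp (Measure.measurable_dirac.comp (hz i j))).const_mul _

end Measures

section Sampling

variable {X W Y A : Type*} [MeasurableSpace X] [MeasurableSpace W] [MeasurableSpace Y]
  [MeasurableSpace A] {n : ℕ}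

instance instIsMarkovKernelPseudoSample (m : ℕ) (Ψ : Kernel ((Fin n → W × Y) × W × Y) X)
    [IsMarkovKernel Ψ] : IsMarkovKernel (pseudoSampleKernel m Ψ) := by
  unfold pseudoSampleKernel; infer_instance

instance instIsMarkovKernelDp (Γ : Fin n → Kernel A (Measure (X × Y))) [∀ i, IsMarkovKernel (Γ i)]
    (Γ' : Fin n → Kernel A (Measure X)) [∀ i, IsMarkovKernel (Γ' i)] :
    IsMarkovKernel (dpKernel Γ Γ') := by
  unfold dpKernel; infer_instance

end Sampling

/-! ### Bias and mean fluctuation of the averaged posteriors -/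

namespace PDKernel

variable {Z A : Type*} [MeasurableSpace Z] [MeasurableSpace A] {k : PDKernel Z} {B : ℝ}

theorem IsBounded.integrable_mmd (h : k.IsBounded B) {P Q : A → Measure Z} (hP : Measurable P)
    (hQ : Measurable Q) (hP' : ∀ s, IsProbabilityMeasure (P s))
    (hQ' : ∀ s, IsProbabilityMeasure (Q s)) (μ : Measure A) [IsFiniteMeasure μ] :
    Integrable (fun s => k.mmd (P s) (Q s)) μ := by
  let κ : Kernel A Z := ⟨P, hP⟩
  let η : Kernel A Z := ⟨Q, hQ⟩
  have : IsMarkovKernel κ := ⟨hP'⟩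
  have : IsMarkovKernel η := ⟨hQ'⟩
  refine Integrable.of_bound (h.measurable_mmd κ η).aestronglyMeasurable (2 * √B)
    (ae_of_all _ fun s => ?_)
  rw [Real.norm_of_nonneg (k.mmd_nonneg _ _)]
  exact h.mmd_le (κ s) (η s)

theorem IsBounded.mmd_smul_add_smul_le (h : k.IsBounded B) {α β : ℝ} (hα : 0 ≤ α) (hβ : 0 ≤ β)
    (hαβ : α + β = 1) (P Q R : Measure Z) [IsFiniteMeasure Q] [IsFiniteMeasure R] :
    k.mmd P (ENNReal.ofReal α • Q + ENNReal.ofReal β • R) ≤ α * k.mmd P Q + β * k.mmd P R := by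
  have f1 : IsFiniteMeasure (ENNReal.ofReal α • Q) := Measure.smul_finite _ ENNReal.ofReal_ne_top
  have f2 : IsFiniteMeasure (ENNReal.ofReal β • R) := Measure.smul_finite _ ENNReal.ofReal_ne_top
  have e : k.meanEmbedding P - (α • k.meanEmbedding Q + β • k.meanEmbedding R)
      = α • (k.meanEmbedding P - k.meanEmbedding Q)
        + β • (k.meanEmbedding P - k.meanEmbedding R) := by
    have : k.meanEmbedding P = (α + β) • k.meanEmbedding P := by rw [hαβ, one_smul]
    nth_rewrite 1 [this]
    module
  rw [mmd, h.meanEmbedding_add, h.meanEmbedding_smul ENNReal.ofReal_ne_top,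
    h.meanEmbedding_smul ENNReal.ofReal_ne_top, ENNReal.toReal_ofReal hα,
    ENNReal.toReal_ofReal hβ, e]
  refine (norm_add_le _ _).trans_eq ?_
  rw [norm_smul, norm_smul, Real.norm_of_nonneg hα, Real.norm_of_nonneg hβ, mmd, mmd]

theorem IsBounded.mmd_avgMeasure_baseMeasure_le (h : k.IsBounded B) {n m : ℕ} (hn : 1 ≤ n)
    (hm : 1 ≤ m) {c : ℝ} (hc : 0 < c) (P : Measure Z) (Q : Fin n → Measure Z)
    [∀ i, IsProbabilityMeasure (Q i)] (z : Fin n → Fin m → Z) :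
    k.mmd P (avgMeasure fun i => baseMeasure c (Q i) (z i))
      ≤ c / (c + m) * k.mmd P (avgMeasure Q) + m / (c + m) * k.mmd P (empirical z) := by
  have := isProbabilityMeasure_avgMeasure hn Q
  have := isProbabilityMeasure_empirical hn hm z
  rw [avgMeasure_baseMeasure hm]
  exact h.mmd_smul_add_smul_le (by positivity) (by positivity) (by field_simp) _ _ _

theorem IsBounded.aemeasurable_mmd_avgMeasure (h : k.IsBounded B) {n : ℕ} (hn : 1 ≤ n)
    {μ : Measure (Fin n → Measure Z)} (hμ : ∀ᵐ P ∂μ, ∀ i, IsProbabilityMeasure (P i))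
    (F : Measure Z) [IsProbabilityMeasure F] :
    AEMeasurable (fun P => k.mmd (avgMeasure P) F) μ := by
  -- Measurability is available along finite kernels, so arbitrary families of measures are first
  -- sent through `probKernel`, which changes nothing almost everywhere.
  refine ⟨fun P => k.mmd (probKernel Z (avgMeasure P)) F,
    h.measurable_mmd ((probKernel Z).comap avgMeasure measurable_avgMeasure) (Kernel.const _ F), ?_⟩
  filter_upwards [hμ] with P hP
  have := isProbabilityMeasure_avgMeasure hn P
  rw [probKernel_apply]

theorem IsBounded.memLp_mmd_avgMeasure (h : k.IsBounded B) {n : ℕ} (hn : 1 ≤ n)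
    {μ : Measure (Fin n → Measure Z)} [IsFiniteMeasure μ]
    (hμ : ∀ᵐ P ∂μ, ∀ i, IsProbabilityMeasure (P i)) (F : Measure Z) [IsProbabilityMeasure F]
    (p : ℝ≥0∞) : MemLp (fun P => k.mmd (avgMeasure P) F) p μ := by
  refine MemLp.of_bound (h.aemeasurable_mmd_avgMeasure hn hμ F).aestronglyMeasurable (2 * √B) ?_
  filter_upwards [hμ] with P hP
  have := isProbabilityMeasure_avgMeasure hn P
  rw [Real.norm_of_nonneg (k.mmd_nonneg _ _)]
  exact h.mmd_le _ _

theorem IsBounded.integral_mmd_avgMeasure_le (h : k.IsBounded B) {a : ℝ} (ha : 0 < a) {n : ℕ}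
    (hn : 1 ≤ n) {F : Fin n → Measure Z} {ν : Fin n → Measure (Measure Z)}
    [∀ i, IsProbabilityMeasure (F i)] [∀ i, IsProbabilityMeasure (ν i)]
    (hν : ∀ i, IsDirichletProcess a (F i) (ν i)) :
    ∫ P, k.mmd (avgMeasure P) (avgMeasure F) ∂(Measure.pi ν) ≤ √(B / (n * (a + 1))) := by
  have := isProbabilityMeasure_avgMeasure hn F
  refine Real.le_sqrt_of_sq_le ?_
  have hL := h.memLp_mmd_avgMeasure hn (ae_pi_isProbabilityMeasure hν) (avgMeasure F) 2
  -- Jensen's inequality for the square, in the form that a variance is nonnegative.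
  have hv := variance_nonneg (fun P => k.mmd (avgMeasure P) (avgMeasure F)) (Measure.pi ν)
  rw [variance_eq_sub hL] at hv
  have := h.integral_mmd_avgMeasure_sq_le ha hn hν
  simp only [Pi.pow_apply] at hv
  linarith

end PDKernel

/-! ### The risk of a minimiser of the objective -/

section Risk

open PDKernel

variable {X Y : Type*} [MeasurableSpace X] [MeasurableSpace Y] {kX : PDKernel X} {kY : PDKernel Y}
  {κX κY L : ℝ} {n : ℕ}

/-- The path from `P` to `P.fst ⊗ₘ η` runs through `avgMeasure p.1` and `avgMeasure p.2 ⊗ₘ η`, and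
the objective at `η'` is bounded by the reverse path. Each error is met once on each path, hence the
factors `2`. -/
theorem risk_le_of_objective_le (hX : kX.IsBounded κX) (hY : kY.IsBounded κY)
    {C C' : kX.H →L[ℝ] kY.H} {η η' : Kernel X Y} [IsMarkovKernel η] [IsMarkovKernel η']
    (hC : ∀ x, C (kX.feature x) = kY.meanEmbedding (η x)) (hL : ‖C‖ ≤ L)
    (hC' : ∀ x, C' (kX.feature x) = kY.meanEmbedding (η' x)) (hL' : ‖C'‖ ≤ L)
    (P : Measure (X × Y)) [IsFiniteMeasure P]
    (p : (Fin n → Measure (X × Y)) × (Fin n → Measure X)) [IsFiniteMeasure (avgMeasure p.2)]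
    (h : objective (kX.prod kY) p η ≤ objective (kX.prod kY) p η') :
    risk (kX.prod kY) P η ≤ risk (kX.prod kY) P η' + 2 * (kX.prod kY).mmd P (avgMeasure p.1)
      + 2 * (L * kX.mmdSq P.fst (avgMeasure p.2)) := by
  have h1 := hX.mmd_compProd_le hY hC hL P.fst (avgMeasure p.2)
  have h2 := hX.mmd_compProd_le hY hC' hL' P.fst (avgMeasure p.2)
  have t1 := (kX.prod kY).mmd_triangle P (avgMeasure p.1) (P.fst ⊗ₘ η)
  have t2 := (kX.prod kY).mmd_triangle (avgMeasure p.1) (avgMeasure p.2 ⊗ₘ η) (P.fst ⊗ₘ η)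
  have t3 := (kX.prod kY).mmd_triangle (avgMeasure p.1) P (avgMeasure p.2 ⊗ₘ η')
  have t4 := (kX.prod kY).mmd_triangle P (P.fst ⊗ₘ η') (avgMeasure p.2 ⊗ₘ η')
  rw [mmd_comm _ (avgMeasure p.1) P] at t3
  rw [mmd_comm _ (avgMeasure p.2 ⊗ₘ η)] at t2
  unfold objective at h
  unfold risk
  linarith

variable {Θ : Type*} {m : ℕ} {c : ℝ}

/-- The conditional bound, given the data and the pseudo-samples. -/
theorem integral_risk_le (hX : kX.IsBounded κX) (hY : kY.IsBounded κY)
    (Pg : Θ → Kernel X Y) [∀ θ, IsMarkovKernel (Pg θ)] {C : Θ → kX.H →L[ℝ] kY.H}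
    (hC : ∀ θ x, C θ (kX.feature x) = kY.meanEmbedding (Pg θ x)) (hL0 : 0 ≤ L)
    (hL : ∀ θ, ‖C θ‖ ≤ L) (hn : 1 ≤ n) (hm : 1 ≤ m) (hc : 0 < c)
    (P : Measure (X × Y)) [IsProbabilityMeasure P]
    (Q : Fin n → Measure (X × Y)) [∀ i, IsProbabilityMeasure (Q i)]
    (Q' : Fin n → Measure X) [∀ i, IsProbabilityMeasure (Q' i)]
    (z : Fin n → Fin m → X × Y) (x : Fin n → Fin m → X)
    (ν : Fin n → Measure (Measure (X × Y))) [∀ i, IsProbabilityMeasure (ν i)]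
    (hν : ∀ i, IsDirichletProcess (c + m) (baseMeasure c (Q i) (z i)) (ν i))
    (ν' : Fin n → Measure (Measure X)) [∀ i, IsProbabilityMeasure (ν' i)]
    (hν' : ∀ i, IsDirichletProcess (c + m) (baseMeasure c (Q' i) (x i)) (ν' i))
    (θhat : (Fin n → Measure (X × Y)) × (Fin n → Measure X) → Θ)
    (hθhat : ∀ᵐ p ∂((Measure.pi ν).prod (Measure.pi ν')), ∀ θ,
      objective (kX.prod kY) p (Pg (θhat p)) ≤ objective (kX.prod kY) p (Pg θ)) :
    ∫ p, risk (kX.prod kY) P (Pg (θhat p)) ∂((Measure.pi ν).prod (Measure.pi ν'))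
      ≤ (⨅ θ, risk (kX.prod kY) P (Pg θ))
        + 2 * (√(κX * κY / (n * (c + m + 1))) + L * √(κX * κX / (n * (c + m + 1))))
        + (2 * c / (c + m) * (L * kX.mmdSq P.fst (avgMeasure Q') + (kX.prod kY).mmd P (avgMeasure Q))
          + 2 * m / (c + m)
            * (L * kX.mmdSq P.fst (empirical x) + (kX.prod kY).mmd P (empirical z))) := by
  have hK := hX.prod hY
  have : ∀ i, IsProbabilityMeasure (baseMeasure c (Q i) (z i)) :=
    fun i => isProbabilityMeasure_baseMeasure hc (Q i) (z i)
  have : ∀ i, IsProbabilityMeasure (baseMeasure c (Q' i) (x i)) :=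
    fun i => isProbabilityMeasure_baseMeasure hc (Q' i) (x i)
  obtain ⟨F, hF⟩ : ∃ F : Measure (X × Y), F = avgMeasure fun i => baseMeasure c (Q i) (z i) :=
    ⟨_, rfl⟩
  obtain ⟨F', hF'⟩ : ∃ F' : Measure X, F' = avgMeasure fun i => baseMeasure c (Q' i) (x i) :=
    ⟨_, rfl⟩
  have iF : IsProbabilityMeasure F := hF ▸ isProbabilityMeasure_avgMeasure hn _
  have iF' : IsProbabilityMeasure F' := hF' ▸ isProbabilityMeasure_avgMeasure hn _
  have hcm : 0 < c + m := by positivity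
  have hp := ae_pi_isProbabilityMeasure hν
  have hp' := ae_pi_isProbabilityMeasure hν'
  have i1 := (hK.memLp_mmd_avgMeasure hn hp F 1).integrable le_rfl
  have i2 := (hX.sq.memLp_mmd_avgMeasure hn hp' F' 1).integrable le_rfl
  have b1 := hK.integral_mmd_avgMeasure_le hcm hn hν
  have b2 := hX.sq.integral_mmd_avgMeasure_le hcm hn hν'
  rw [← hF] at b1
  rw [← hF'] at b2
  have m1 := hK.mmd_avgMeasure_baseMeasure_le hn hm hc P Q z
  have m2 := hX.sq.mmd_avgMeasure_baseMeasure_le hn hm hc P.fst Q' x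
  rw [← hF] at m1
  rw [← hF'] at m2
  have := isProbabilityMeasure_avgMeasure hn Q'
  have := isProbabilityMeasure_empirical hn hm x
  rw [hX.mmdSq_eq, hX.mmdSq_eq]
  set R := (⨅ θ, risk (kX.prod kY) P (Pg θ)) with hR
  -- `F` and `F'`, the averaged base measures, separate the random fluctuation (first bracket) from
  -- the deterministic bias (second bracket).
  have hpt : ∀ᵐ p ∂((Measure.pi ν).prod (Measure.pi ν')), risk (kX.prod kY) P (Pg (θhat p))
      ≤ (2 * (kX.prod kY).mmd (avgMeasure p.1) F + 2 * L * kX.sq.mmd (avgMeasure p.2) F')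
        + (R + 2 * (kX.prod kY).mmd P F + 2 * L * kX.sq.mmd P.fst F') := by
    filter_upwards [hθhat, Measure.quasiMeasurePreserving_snd.ae hp'] with p hθ hP'
    have := isProbabilityMeasure_avgMeasure hn p.2
    have : Nonempty Θ := ⟨θhat p⟩
    have t1 := (kX.prod kY).mmd_triangle P F (avgMeasure p.1)
    have t2 := kX.sq.mmd_triangle P.fst F' (avgMeasure p.2)
    rw [mmd_comm _ F] at t1
    rw [mmd_comm _ F'] at t2
    -- The errors do not depend on `θ`; with them on the left the infimum can be taken, whether or
    -- not it is attained.
    have hinf : risk (kX.prod kY) P (Pg (θhat p)) - 2 * (kX.prod kY).mmd P (avgMeasure p.1)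
        - 2 * (L * kX.sq.mmd P.fst (avgMeasure p.2)) ≤ R := by
      refine le_ciInf fun θ => ?_
      have := risk_le_of_objective_le hX hY (hC _) (hL _) (hC θ) (hL θ) P p (hθ θ)
      rw [hX.mmdSq_eq] at this
      linarith
    have := mul_le_mul_of_nonneg_left t2 hL0
    linarith
  have j1 : Integrable (fun p : (Fin n → Measure (X × Y)) × (Fin n → Measure X) =>
      2 * (kX.prod kY).mmd (avgMeasure p.1) F) ((Measure.pi ν).prod (Measure.pi ν')) :=
    (i1.comp_fst _).const_mul 2
  have j2 : Integrable (fun p : (Fin n → Measure (X × Y)) × (Fin n → Measure X) =>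
      2 * L * kX.sq.mmd (avgMeasure p.2) F') ((Measure.pi ν).prod (Measure.pi ν')) :=
    (i2.comp_snd _).const_mul (2 * L)
  have j3 : Integrable (fun p : (Fin n → Measure (X × Y)) × (Fin n → Measure X) =>
      2 * (kX.prod kY).mmd (avgMeasure p.1) F + 2 * L * kX.sq.mmd (avgMeasure p.2) F')
      ((Measure.pi ν).prod (Measure.pi ν')) := j1.add j2
  have e1 := integral_fun_fst (μ := Measure.pi ν) (ν := Measure.pi ν')
    (fun p => (kX.prod kY).mmd (avgMeasure p) F)
  have e2 := integral_fun_snd (μ := Measure.pi ν) (ν := Measure.pi ν')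
    (fun p => kX.sq.mmd (avgMeasure p) F')
  -- Only the dominating side must be integrable; the risk enters through its nonnegativity.
  have hint := integral_mono_of_nonneg (ae_of_all _ fun p => mmd_nonneg _ _ _)
    (j3.add (integrable_const (R + 2 * (kX.prod kY).mmd P F + 2 * L * kX.sq.mmd P.fst F'))) hpt
  simp only [Pi.add_apply] at hint
  rw [integral_add j3 (integrable_const _), integral_add j1 j2, integral_const_mul,
    integral_const_mul, e1, e2] at hint
  simp only [probReal_univ, one_smul, integral_const] at hint
  have g1 := mul_le_mul_of_nonneg_left b2 hL0
  have g2 := mul_le_mul_of_nonneg_left m2 hL0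
  refine hint.trans ?_
  have hexp : 2 * c / (c + m) * (L * kX.sq.mmd P.fst (avgMeasure Q')
        + (kX.prod kY).mmd P (avgMeasure Q))
      + 2 * m / (c + m) * (L * kX.sq.mmd P.fst (empirical x) + (kX.prod kY).mmd P (empirical z))
      = 2 * (L * (c / (c + m) * kX.sq.mmd P.fst (avgMeasure Q')
          + m / (c + m) * kX.sq.mmd P.fst (empirical x)))
        + 2 * (c / (c + m) * (kX.prod kY).mmd P (avgMeasure Q)
          + m / (c + m) * (kX.prod kY).mmd P (empirical z)) := by ring
  rw [hexp]
  linarith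

end Risk

end

/-! ### The generalisation error bound -/

theorem theorem1
    -- spaces of latent covariates, of their noisy observations, of outcomes, and the parameter set
    {d : ℕ} (hd : 1 ≤ d) (𝒳 𝒲 : Set (EuclideanSpace ℝ (Fin d))) (𝒴 : Set ℝ)
    {Θ : Type*} [MeasurableSpace Θ]
    (n m : ℕ) (hn : 1 ≤ n) (hm : 1 ≤ m) (c : ℝ) (hc : 0 < c)
    -- true joint law of `(X, W, Y)`
    (P₀ : Measure (𝒳 × 𝒲 × 𝒴)) [IsProbabilityMeasure P₀]
    -- model-implied conditional laws of `Y` given `X = x`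
    (Pg : Θ → Kernel 𝒳 𝒴) [∀ θ, IsMarkovKernel (Pg θ)]
    -- product kernel of bounded, measurable, characteristic kernels
    (kX : PDKernel 𝒳) (kY : PDKernel 𝒴) (κX κY : ℝ)
    (hkX : Measurable fun p : 𝒳 × 𝒳 => kX p.1 p.2)
    (hkY : Measurable fun p : 𝒴 × 𝒴 => kY p.1 p.2)
    (hcharX : kX.IsCharacteristic) (hcharY : kY.IsCharacteristic)
    (hκX : IsLUB (Set.range fun p : 𝒳 × 𝒳 => kX p.1 p.2) κX)
    (hκY : IsLUB (Set.range fun p : 𝒴 × 𝒴 => kY p.1 p.2) κY)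
    -- uniformly bounded conditional mean embedding operators
    (C : Θ → kX.H →L[ℝ] kY.H) (Λ : ℝ)
    (hC : ∀ θ x, C θ (kX.feature x) = kY.meanEmbedding (Pg θ x))
    (hΛ : IsLUB (Set.range fun θ => ‖C θ‖) Λ)
    -- working-model posteriors of `X` given `(θ, w, y)` and of `θ` given the data
    (postX : Kernel (Θ × 𝒲 × 𝒴) 𝒳) [IsMarkovKernel postX]
    (postΘ : Kernel (Fin n → 𝒲 × 𝒴) Θ) [IsMarkovKernel postΘ]
    -- prior centring measures, possibly data-dependent
    (QXY : Fin n → Kernel (Fin n → 𝒲 × 𝒴) (𝒳 × 𝒴)) [∀ i, IsMarkovKernel (QXY i)]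
    (QX : Fin n → Kernel (Fin n → 𝒲 × 𝒴) 𝒳) [∀ i, IsMarkovKernel (QX i)]
    -- the law of `(D, S)`
    (Pr : Measure ((Fin n → 𝒲 × 𝒴) × (Fin n → Fin m → 𝒳)))
    (hPr : Pr = dataLaw m P₀.snd (predictive postX postΘ))
    -- laws of the joint and marginal DP posteriors given `(D, S)`
    (Γ : Fin n → Kernel ((Fin n → 𝒲 × 𝒴) × (Fin n → Fin m → 𝒳)) (Measure (𝒳 × 𝒴)))
    [∀ i, IsMarkovKernel (Γ i)]
    (hΓ : ∀ i, ∀ᵐ s ∂Pr, IsDirichletProcess (c + m)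
      (baseMeasure c (QXY i s.1) fun j => (s.2 i j, (s.1 i).2)) (Γ i s))
    (Γ' : Fin n → Kernel ((Fin n → 𝒲 × 𝒴) × (Fin n → Fin m → 𝒳)) (Measure 𝒳))
    [∀ i, IsMarkovKernel (Γ' i)]
    (hΓ' : ∀ i, ∀ᵐ s ∂Pr, IsDirichletProcess (c + m)
      (baseMeasure c (QX i s.1) fun j => s.2 i j) (Γ' i s))
    -- the estimator, a minimiser of the objective
    (θhat : ((Fin n → 𝒲 × 𝒴) × (Fin n → Fin m → 𝒳)) ×
      ((Fin n → Measure (𝒳 × 𝒴)) × (Fin n → Measure 𝒳)) → Θ)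
    (hθhat : ∀ᵐ ω ∂(Pr ⊗ₘ dpKernel Γ Γ'), ∀ θ,
      objective (kX.prod kY) ω.2 (Pg (θhat ω)) ≤ objective (kX.prod kY) ω.2 (Pg θ))
    -- the true laws of `(X, Y)` and of `X`
    (PXY : Measure (𝒳 × 𝒴)) (hPXY : PXY = P₀.map fun t => (t.1, t.2.2))
    (PX : Measure 𝒳) (hPX : PX = P₀.fst)
    (hmeas : AEMeasurable (fun ω => risk (kX.prod kY) PXY (Pg (θhat ω))) (Pr ⊗ₘ dpKernel Γ Γ')) :
    (∫ s, ∫ p, risk (kX.prod kY) PXY (Pg (θhat (s, p))) ∂(dpKernel Γ Γ' s) ∂Pr)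
        - (⨅ θ, risk (kX.prod kY) PXY (Pg θ))
      ≤ 2 * (√(κX * κY) + Λ * κX) / √(n * (c + m + 1))
        + 2 * c / (c + m) * ∫ s, (Λ * kX.mmdSq PX (avgMeasure fun i => QX i s.1)
            + (kX.prod kY).mmd PXY (avgMeasure fun i => QXY i s.1)) ∂Pr
        + 2 * m / (c + m) * ∫ s, (Λ * kX.mmdSq PX (empirical s.2)
            + (kX.prod kY).mmd PXY (empirical fun i j => (s.2 i j, (s.1 i).2))) ∂Pr
    ∧ (κX ≤ κY →
      (∫ s, ∫ p, risk (kX.prod kY) PXY (Pg (θhat (s, p))) ∂(dpKernel Γ Γ' s) ∂Pr)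
          - (⨅ θ, risk (kX.prod kY) PXY (Pg θ))
        ≤ 2 * √(κX * κY) * (1 + Λ) / √(n * (c + m + 1))
          + 2 * c / (c + m) * ∫ s, (Λ * kX.mmdSq PX (avgMeasure fun i => QX i s.1)
              + (kX.prod kY).mmd PXY (avgMeasure fun i => QXY i s.1)) ∂Pr
          + 2 * m / (c + m) * ∫ s, (Λ * kX.mmdSq PX (empirical s.2)
              + (kX.prod kY).mmd PXY (empirical fun i j => (s.2 i j, (s.1 i).2))) ∂Pr) := by
  obtain ⟨x₀, -, y₀⟩ := (nonempty_of_isProbabilityMeasure P₀).some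
  have hX : kX.IsBounded κX := ⟨hkX, fun z => hκX.1 ⟨(z, z), rfl⟩⟩
  have hY : kY.IsBounded κY := ⟨hkY, fun z => hκY.1 ⟨(z, z), rfl⟩⟩
  have hκX0 : 0 ≤ κX := (kX.diag_nonneg x₀).trans (hX.diag_le x₀)
  have hκY0 : 0 ≤ κY := (kY.diag_nonneg y₀).trans (hY.diag_le y₀)
  have hL : ∀ θ, ‖C θ‖ ≤ Λ := fun θ => hΛ.1 ⟨θ, rfl⟩
  have hprob : IsProbabilityMeasure Pr := by
    rw [hPr, dataLaw]; infer_instance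
  have hmXY : Measurable fun t : 𝒳 × 𝒲 × 𝒴 => (t.1, t.2.2) := by fun_prop
  have : IsProbabilityMeasure PXY := by
    rw [hPXY]; exact Measure.isProbabilityMeasure_map hmXY.aemeasurable
  have hfst : PXY.fst = PX := by
    rw [hPXY, hPX, Measure.fst, Measure.fst, Measure.map_map measurable_fst hmXY]
    rfl
  have : IsProbabilityMeasure PX := hfst ▸ inferInstance
  -- A supremum of norms is nonnegative once `Θ` has a point; a value of the estimator provides one.
  have hΛ0 : 0 ≤ Λ := by
    obtain ⟨s⟩ := nonempty_of_isProbabilityMeasure Pr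
    obtain ⟨p⟩ := nonempty_of_isProbabilityMeasure (dpKernel Γ Γ' s)
    exact (norm_nonneg (C (θhat (s, p)))).trans (hL _)
  have hK := hX.prod hY
  have q1 : Integrable (fun s => kX.mmdSq PX (avgMeasure fun i => QX i s.1)) Pr := by
    have := hX.sq.integrable_mmd (A := (Fin n → 𝒲 × 𝒴) × (Fin n → Fin m → 𝒳)) (P := fun _ => PX)
      (Q := fun s => avgMeasure fun i => QX i s.1) measurable_const
      (measurable_avgMeasure.comp (measurable_pi_lambda _ fun i =>
        (QX i).measurable.comp measurable_fst)) (fun _ => inferInstance)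
      (fun s => isProbabilityMeasure_avgMeasure hn _) Pr
    refine this.congr (ae_of_all _ fun s => ?_)
    have := isProbabilityMeasure_avgMeasure hn fun i => QX i s.1
    exact (hX.mmdSq_eq _ _).symm
  have q2 : Integrable (fun s => (kX.prod kY).mmd PXY (avgMeasure fun i => QXY i s.1)) Pr :=
    hK.integrable_mmd (A := (Fin n → 𝒲 × 𝒴) × (Fin n → Fin m → 𝒳)) (P := fun _ => PXY)
      (Q := fun s => avgMeasure fun i => QXY i s.1) measurable_const
      (measurable_avgMeasure.comp (measurable_pi_lambda _ fun i =>
        (QXY i).measurable.comp measurable_fst)) (fun _ => inferInstance)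
      (fun s => isProbabilityMeasure_avgMeasure hn _) Pr
  have q3 : Integrable (fun s => kX.mmdSq PX (empirical s.2)) Pr := by
    have := hX.sq.integrable_mmd (A := (Fin n → 𝒲 × 𝒴) × (Fin n → Fin m → 𝒳)) (P := fun _ => PX)
      (Q := fun s => empirical s.2) measurable_const
      (measurable_empirical fun i j => by fun_prop) (fun _ => inferInstance)
      (fun s => isProbabilityMeasure_empirical hn hm _) Pr
    refine this.congr (ae_of_all _ fun s => ?_)
    have := isProbabilityMeasure_empirical hn hm s.2
    exact (hX.mmdSq_eq _ _).symm
  have q4 : Integrable (fun s => (kX.prod kY).mmd PXY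
      (empirical fun i j => (s.2 i j, (s.1 i).2))) Pr :=
    hK.integrable_mmd (A := (Fin n → 𝒲 × 𝒴) × (Fin n → Fin m → 𝒳)) (P := fun _ => PXY)
      (Q := fun s => empirical fun i j => (s.2 i j, (s.1 i).2)) measurable_const
      (measurable_empirical fun i j => by fun_prop) (fun _ => inferInstance)
      (fun s => isProbabilityMeasure_empirical hn hm _) Pr
  have r1 : Integrable (fun s => 2 * c / (c + m) * (Λ * kX.mmdSq PX (avgMeasure fun i => QX i s.1)
      + (kX.prod kY).mmd PXY (avgMeasure fun i => QXY i s.1))) Pr :=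
    ((q1.const_mul Λ).add q2).const_mul _
  have r2 : Integrable (fun s => 2 * m / (c + m) * (Λ * kX.mmdSq PX (empirical s.2)
      + (kX.prod kY).mmd PXY (empirical fun i j => (s.2 i j, (s.1 i).2)))) Pr :=
    ((q3.const_mul Λ).add q4).const_mul _
  have r3 : Integrable (fun s => 2 * c / (c + m) * (Λ * kX.mmdSq PX (avgMeasure fun i => QX i s.1)
      + (kX.prod kY).mmd PXY (avgMeasure fun i => QXY i s.1))
      + 2 * m / (c + m) * (Λ * kX.mmdSq PX (empirical s.2)
      + (kX.prod kY).mmd PXY (empirical fun i j => (s.2 i j, (s.1 i).2)))) Pr := r1.add r2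
  have hmain := integral_mono_of_nonneg
    (ae_of_all Pr fun s => integral_nonneg
      (μ := dpKernel Γ Γ' s) (f := fun p => risk (kX.prod kY) PXY (Pg (θhat (s, p))))
      fun p => PDKernel.mmd_nonneg _ _ _)
    ((integrable_const ((⨅ θ, risk (kX.prod kY) PXY (Pg θ))
        + 2 * (√(κX * κY / (n * (c + m + 1))) + Λ * √(κX * κX / (n * (c + m + 1)))))).add r3) (by
      filter_upwards [ae_all_iff.2 hΓ, ae_all_iff.2 hΓ', Measure.ae_ae_of_ae_compProd hθhat]
        with s h1 h2 h3
      -- Given `(D, S) = s` the draws form a product law, so the conditional bound applies.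
      have h4 : dpKernel Γ Γ' s = (Measure.pi fun i => Γ i s).prod (Measure.pi fun i => Γ' i s) := by
        rw [dpKernel, Kernel.prod_apply]; rfl
      rw [h4] at h3 ⊢
      have := integral_risk_le hX hY Pg hC hΛ0 hL hn hm hc PXY (fun i => QXY i s.1)
        (fun i => QX i s.1) (fun i j => (s.2 i j, (s.1 i).2)) s.2 (fun i => Γ i s) h1
        (fun i => Γ' i s) h2 (fun p => θhat (s, p)) h3
      rw [hfst] at this
      exact this)
  simp only [Pi.add_apply] at hmain
  rw [integral_add (integrable_const _) r3,
    integral_add r1 r2, integral_const_mul, integral_const_mul, integral_const, probReal_univ,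
    one_smul, Real.sqrt_div (mul_nonneg hκX0 hκY0), Real.sqrt_div (mul_nonneg hκX0 hκX0),
    Real.sqrt_mul_self hκX0] at hmain
  have hN : 0 ≤ √(n * (c + m + 1)) := Real.sqrt_nonneg _
  have hfirst : 2 * (√(κX * κY) / √(n * (c + m + 1)) + Λ * (κX / √(n * (c + m + 1))))
      = 2 * (√(κX * κY) + Λ * κX) / √(n * (c + m + 1)) := by ring
  rw [hfirst] at hmain
  refine ⟨by linarith, fun hle => ?_⟩
  -- Here `κX² ≤ κX κY`, so `κX` may be replaced by `√(κX κY)`.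
  have hκ : κX ≤ √(κX * κY) := Real.le_sqrt_of_sq_le (by nlinarith)
  have hsecond : 2 * (√(κX * κY) + Λ * κX) / √(n * (c + m + 1))
      ≤ 2 * √(κX * κY) * (1 + Λ) / √(n * (c + m + 1)) := by
    refine div_le_div_of_nonneg_right ?_ hN
    linarith [mul_le_mul_of_nonneg_left hκ hΛ0]
  linarith
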